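/- **Setting.** There are $N$ independent students. For student $i$ let $Z_i^*\sim N(0,\Sigma)$ in $\mathbb R^p$, where $\Sigma$ is positive definite with unit diagonal, and let $Z_{ij}=F_j(Z^*_{ij})$. For a continuous predictor $F_j(t)=c_j+d_jt$ with $d_j>0$; for a binary or ordinal predictor with categories $0,\dots,K_j$, $F_j(t)=k$ if $t\in(c_{jk},c_{j,k+1}]$, where $-\infty=c_{j0}<c_{j1}<\dots<c_{jK_j}<c_{j,K_j+1}=\infty$. Given $Z_i$, the proficiency $\theta_i$ is $N(\beta_0+\sum_j\beta_j^\top g_j(Z_{ij}),\sigma^2)$ with $\sigma^2>0$, where $g_j$ is the identity for continuous and binary predictors and the vector of dummy variables $(\mathbb I(Z_{ij}\ge1),\dots,\mathbb I(Z_{ij}\ge K_j))$ for ordinal ones. Given $\theta_i$, the responses $Y_i=(Y_{il})_l$ to the items assigned to student $i$ are independent and follow two-parameter logistic or generalised partial credit models with known item parameters. Only $Z_i^{\rm obs}=(Z_{ij})_{j\in\mathcal A_i}$ is observed. The random set $\mathcal A_i$ is conditionally independent of $Y_i$ given $Z_i$, and $\mathbb P(\mathcal A_i=\alpha\mid Z_i=z)$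 depends only on $\alpha$ and $(z_j)_{j\in\alpha\cap\mathcal S^*}$, where $\mathcal S^*=\{j:\beta_j\ne0\}$. Predictors $j\notin\mathcal S^*$ are called null. Let $\mathbb P$ be this true model, and let $\mathbb Q$ be a (fixed) plug-in model of the same form with parameters $\hat\Sigma,\hat c,\hat d,\hat\beta_0,\hat\beta,\hat\sigma^2$ satisfying the same constraints. Let $S$ be a diagonal matrix such that $$G=\begin{pmatrix}\hat\Sigma&\hat\Sigma-S\\ \hat\Sigma-S&\hat\Sigma\end{pmatrix}$$ is positive definite. **Procedure.** For each run $m=1,\dots,M$, conditionally independently given the observed data, and for each $i$: sample $Z_i^*$ from its conditional law given $(Z_i^{\rm obs},Y_i)$ under $\mathbb Q$; sample $\tilde Z_i^*$ given $Z_i^*$ such that $(Z_i^*,\tilde Z_i^*)\sim N(0,G)$ (conditional law); the knockoffs are $\tilde Z^{(m)}_{ij}=\hat F_j(\tilde Z_{ij}^*)$, $j\in\mathcal A_i$. Let $W^{(m)}=w(Z^{\rm obs},\tilde Z^{{\rm obs},(m)},Y)\in\mathbb R^p$, where $w$ either has the flip-sign property (swapping, for all $j$ in a set $T$ and all $i$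 with $j\in\mathcal A_i$, the values $Z_{ij}$ and $\tilde Z_{ij}$ changes the sign of $w_j$ for $j\in T$ and leaves $w_j$ unchanged for $j\notin T$), or is the likelihood-based statistic $$w_j=\operatorname{sign}(\|\hat b_j^\dagger\|-\|\hat\gamma_j^\dagger\|)\max\{\|\hat b_j^\dagger\|,\|\hat\gamma_j^\dagger\|\}/\sqrt{p_j}.$$ Here $(\hat b,\hat\gamma)$ are the slopes of the predictors and of the knockoffs in the maximum likelihood estimate (with copula parameters fixed at those of $\mathbb Q$) of the latent regression of $\theta_i$ on all $g_j(Z_{ij})$ and $g_j(\tilde Z_{ij})$, $p_j$ is the dimension of $g_j$, and $\dagger$ denotes multiplication by $\operatorname{Cov}(g_j(Z_{ij}))^{1/2}$ (covariance under $\mathbb Q$); $w=0$ if there is no unique maximiser. For an integer $\nu\ge1$ put $$\tau^{(m)}=\inf\{t>0:1+|\{j:W^{(m)}_j<-t\}|=\nu\},$$ where, if this set is empty, the condition $=\nu$ is replaced by $\le\nu$. Let $\hat{\mathcal S}^{(m)}=\{j:W_j^{(m)}>\tau^{(m)}\}$, $\Pi_j=\frac1M\sum_m\mathbb I(j\in\hat{\mathcal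 S}^{(m)})$ and $\hat{\mathcal S}=\{j:\Pi_j\ge\eta\}$. **Observed divergence.** For a null $j$ and run $m$, let $$\widehat{\rm KL}{}_j^{(m)}=\sum_{i:\,j\in\mathcal A_i}\log\frac{\mathbb P_{ij}(Z_{ij}\mid Z^{\rm obs}_{i,-j},Y_i)\;\mathbb Q_{ij}(\tilde Z^{\rm obs}_{i,-j},\tilde Z_{ij}\mid Z^{\rm obs}_{i,-j},Z_{ij},Y_i)}{\mathbb P_{ij}(\tilde Z_{ij}\mid Z^{\rm obs}_{i,-j},Y_i)\;\mathbb Q_{ij}(\tilde Z^{\rm obs}_{i,-j},Z_{ij}\mid Z^{\rm obs}_{i,-j},\tilde Z_{ij},Y_i)},$$ with the knockoffs $\tilde Z$ of run $m$, where $\mathbb P_{ij}$ is the conditional density of $Z_{ij}$ given $(Z^{\rm obs}_{i,-j},Y_i)$ under $\mathbb P$ and $\mathbb Q_{ij}$ is the conditional density of the knockoffs $(\tilde Z^{\rm obs}_{i,-j},\tilde Z_{ij})$ given $(Z^{\rm obs}_{i,-j},Z_{ij},Y_i)$ under $\mathbb Q$. For $\epsilon\ge0$ let $$\Pi_j^\dagger=\frac1M\sum_{m=1}^M\mathbb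 I\bigl(j\in\hat{\mathcal S}^{(m)}\text{ and }\widehat{\rm KL}{}_j^{(m)}\le\epsilon\bigr).$$ **Theorem.** (1) If $\mathbb P(\Pi_j^\dagger\ge\eta)\le\mathbb E[\Pi_j^\dagger]$ for every $j\notin\mathcal S^*$, then $$\mathbb E\bigl|\{j\in\hat{\mathcal S}\setminus\mathcal S^*:\ \widehat{\rm KL}{}_j^{(m)}\le\epsilon\text{ for all }m=1,\dots,M\}\bigr|\le\nu e^{\epsilon}.$$ (2) Let $M=31$ and $\eta=1/2$. If, for a $j\notin\mathcal S^*$, the probability mass function of $\Pi_j^\dagger$ is non-increasing on $\{0,1/31,\dots,1\}$, then $\mathbb P(\Pi_j^\dagger\ge\eta)\le\mathbb E[\Pi_j^\dagger]$. -/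

import Mathlib

open MeasureTheory ProbabilityTheory
open scoped ENNReal NNReal

noncomputable section

namespace LatentKnockoff

/-! ### Study design: predictors, cognitive items, assignment of items to students -/

/-- A predictor is continuous, or takes the ordered categories `0, …, K`
(`K = 1`: binary, `K > 1`: ordinal). -/
inductive PredictorKind where
  | continuous : PredictorKind
  | categorical (K : ℕ) : PredictorKind

/-- The dimension of the slope of a predictor. -/
def PredictorKind.dim : PredictorKind → ℕ
  | .continuous => 1
  | .categorical K => K

/-- The `k`-th entry (`k = 0, …, dim - 1`) of the transformation `g_j`: the identity for a
continuous predictor, the dummy variables `𝕀(x ≥ 1), …, 𝕀(x ≥ K)` for a categorical one.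
For a binary predictor the only dummy variable is the predictor itself. -/
def PredictorKind.feature : PredictorKind → ℕ → ℝ → ℝ
  | .continuous, _, x => x
  | .categorical _, k, x => open Classical in if (k : ℝ) + 1 ≤ x then 1 else 0

/-- A cognitive item with categories `0, …, K` and known parameters `a`, `b 1, …, b K`. -/
structure Item where
  K : ℕ
  a : ℝ
  b : ℕ → ℝ

/-- Generalised partial credit model (for `K = 1`, the two-parameter logistic model):
the probability of the response `y` given the proficiency `θ`. -/
def Item.prob (it : Item) (y : ℕ) (θ : ℝ) : ℝ :=
  Real.exp (∑ r ∈ Finset.Icc 1 y, (it.a * θ + it.b r)) /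
    ∑ k ∈ Finset.range (it.K + 1), Real.exp (∑ r ∈ Finset.Icc 1 k, (it.a * θ + it.b r))

/-- `N` students, `p` predictors, `J` cognitive items; `assigned i` is the set of items
that student `i` is assigned. -/
structure Study (N p J : ℕ) where
  kind : Fin p → PredictorKind
  item : Fin J → Item
  assigned : Fin N → Finset (Fin J)

variable {N p J : ℕ}

/-- Possible cognitive response vectors of student `i`. -/
abbrev Study.Resp (s : Study N p J) (i : Fin N) : Type :=
  (l : {l : Fin J // l ∈ s.assigned i}) → Fin ((s.item l.1).K + 1)

/-- Observed data of student `i`: the set `A` of observed predictors, the values of the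
predictors (entries outside `A` are recorded as `0`), and the cognitive responses. -/
abbrev Study.Obs (s : Study N p J) (i : Fin N) : Type :=
  Finset (Fin p) × (Fin p → ℝ) × s.Resp i

/-- Observed data of student `i` together with a knockoff copy of the observed predictors. -/
abbrev Study.PairObs (s : Study N p J) (i : Fin N) : Type := s.Obs i × (Fin p → ℝ)

/-- Keep the entries with index in `A` and erase (set to `0`) the others. -/
def mask (A : Finset (Fin p)) (z : Fin p → ℝ) : Fin p → ℝ := fun j => if j ∈ A then z j else 0

/-! ### Latent regression model and Gaussian copula model -/

/-- Slopes: one vector for each predictor. -/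
abbrev Study.Slopes (s : Study N p J) : Type := (j : Fin p) → Fin (s.kind j).dim → ℝ

/-- `β_1ᵀ g_1(z_1) + ⋯ + β_pᵀ g_p(z_p)`. -/
def Study.linPred (s : Study N p J) (β : s.Slopes) (z : Fin p → ℝ) : ℝ :=
  ∑ j, ∑ k, β j k * (s.kind j).feature k (z j)

/-- The probability of the responses `y` of student `i` when the proficiency `θ` has the
distribution `N(m, v)` and the responses are independent given `θ`. -/
def Study.respProb (s : Study N p J) {i : Fin N} (y : s.Resp i) (m : ℝ) (v : ℝ≥0) : ℝ :=
  ∫ θ, ∏ l, (s.item l.1).prob (y l) θ ∂(gaussianReal m v)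

/-- Density of the centred multivariate normal distribution with covariance matrix `S`. -/
def gaussDensity {ι : Type} [Fintype ι] [DecidableEq ι] (S : Matrix ι ι ℝ) (x : ι → ℝ) : ℝ :=
  (Real.sqrt ((2 * Real.pi) ^ Fintype.card ι * S.det))⁻¹ *
    Real.exp (-(x ⬝ᵥ (S⁻¹.mulVec x)) / 2)

/-- Parameters of the Gaussian copula model: the correlation matrix of the underlying normal
variables, location `c_j` and scale `d_j` of the continuous predictors, and cut points
`c_{j1}, …, c_{jK}` of the categorical ones (other entries are not used). -/
structure Copula (p : ℕ) where
  corr : Matrix (Fin p) (Fin p) ℝ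
  loc : Fin p → ℝ
  scale : Fin p → ℝ
  cut : Fin p → ℕ → ℝ

/-- The constraints on the parameters of the Gaussian copula model. -/
structure Copula.Valid (c : Copula p) (s : Study N p J) : Prop where
  posDef : c.corr.PosDef
  diag : ∀ j, c.corr j j = 1
  scale_pos : ∀ j, s.kind j = .continuous → 0 < c.scale j
  cut_lt : ∀ j K, s.kind j = .categorical K →
    ∀ k l, 1 ≤ k → k < l → l ≤ K → c.cut j k < c.cut j l

/-- The transformation `F_j`: `c_j + d_j t` for a continuous predictor; for a categorical one,
the category `k` with `t ∈ (c_{jk}, c_{j,k+1}]`, that is, the number of cut points below `t`. -/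
def Copula.trans (c : Copula p) (s : Study N p J) (j : Fin p) (t : ℝ) : ℝ :=
  match s.kind j with
  | .continuous => c.loc j + c.scale j * t
  | .categorical K => open Classical in (((Finset.Icc 1 K).filter (fun k => c.cut j k < t)).card : ℝ)

/-- The vector of predictors determined by the vector of underlying variables. -/
def Copula.transVec (c : Copula p) (s : Study N p J) (t : Fin p → ℝ) : Fin p → ℝ :=
  fun j => c.trans s j (t j)

/-- Lebesgue measure of the underlying variable `t` along the fibre `F_j t = x`: for a
continuous predictor the point mass `d_j⁻¹` at `(x - c_j) / d_j`, for a categorical one Lebesgue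
measure on the interval of the category `x`. -/
def Copula.fibre (c : Copula p) (s : Study N p J) (j : Fin p) (x : ℝ) : Measure ℝ :=
  match s.kind j with
  | .continuous => ENNReal.ofReal (c.scale j)⁻¹ • Measure.dirac ((x - c.loc j) / c.scale j)
  | .categorical _ => volume.restrict {t | c.trans s j t = x}

/-- Lebesgue measure of the underlying vector along the observation `z_j`, `j ∈ A`: the
coordinates outside `A` are free. Integrating a density of the underlying vector against this
measure gives the density of the observed predictors (with respect to Lebesgue measure for
continuous and counting measure for categorical predictors). -/
def Copula.fibreVec (c : Copula p) (s : Study N p J) (A : Finset (Fin p)) (z : Fin p → ℝ) :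
    Measure (Fin p → ℝ) :=
  Measure.pi fun j => if j ∈ A then c.fibre s j (z j) else volume

/-- A joint model of predictors and responses: Gaussian copula parameters, and intercept,
slopes and residual variance of the structural model. -/
structure Model (s : Study N p J) where
  cop : Copula p
  intercept : ℝ
  slope : s.Slopes
  resVar : ℝ≥0

/-- Admissible parameters. -/
structure Model.Valid {s : Study N p J} (P : Model s) : Prop where
  cop : P.cop.Valid s
  resVar_pos : 0 < P.resVar

/-- The set of non-null predictors: those with a non-zero slope. -/
def Model.nonnull {s : Study N p J} (P : Model s) : Finset (Fin p) :=
  open Classical in Finset.univ.filter fun j => P.slope j ≠ 0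

/-- Conditional probability `f(y | z; β, σ²)` of the responses given the complete predictors. -/
def Model.resp {s : Study N p J} (P : Model s) {i : Fin N} (y : s.Resp i) (z : Fin p → ℝ) : ℝ :=
  s.respProb y (P.intercept + s.linPred P.slope z) P.resVar

/-- Joint density of the observed predictors `z_j`, `j ∈ A`, and the responses `y`. -/
def Model.obsDensity {s : Study N p J} (P : Model s) {i : Fin N} (A : Finset (Fin p))
    (z : Fin p → ℝ) (y : s.Resp i) : ℝ :=
  ∫ t, gaussDensity P.cop.corr t * P.resp y (P.cop.transVec s t) ∂(P.cop.fibreVec s A z)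

/-! ### Missing data -/

/-- `q i A z` is the conditional probability, given the complete predictors `z`, that `A` is
the set of observed predictors of student `i`. -/
structure IsMissingness (q : Fin N → Finset (Fin p) → (Fin p → ℝ) → ℝ) : Prop where
  nonneg : ∀ i A z, 0 ≤ q i A z
  sum_eq_one : ∀ i z, ∑ A, q i A z = 1
  measurable : ∀ i A, Measurable (q i A)

/-- The SMAR condition with respect to the set `T` of predictors: the probability of observing
the set `A` depends on the predictors in `A ∩ T` only. -/
def SMAR (q : Fin N → Finset (Fin p) → (Fin p → ℝ) → ℝ) (T : Finset (Fin p)) : Prop :=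
  ∀ i A z z', (∀ j ∈ A ∩ T, z j = z' j) → q i A z = q i A z'

/-- The law of the observed data of student `i` under the true model: the underlying vector `t`
is normal, the predictors are `F(t)`, and given the predictors, the responses `y` and the set `A`
of observed predictors are independent with probability mass functions `f(y | z)` and
`q(A | z)`. -/
def Model.obsLaw {s : Study N p J} (P : Model s)
    (q : Fin N → Finset (Fin p) → (Fin p → ℝ) → ℝ) (i : Fin N) : Measure (s.Obs i) :=
  (((volume : Measure (Fin p → ℝ)).prod
      ((Measure.count : Measure (s.Resp i)).prod
        (Measure.count : Measure (Finset (Fin p))))).withDensity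
    fun x => ENNReal.ofReal (gaussDensity P.cop.corr x.1 *
      P.resp x.2.1 (P.cop.transVec s x.1) * q i x.2.2 (P.cop.transVec s x.1))).map
    fun x => (x.2.2, mask x.2.2 (P.cop.transVec s x.1), x.2.1)

/-! ### Knockoff generation under a plug-in model -/

/-- The covariance matrix `G` of the underlying variables of predictors and knockoffs, for a
diagonal matrix with entries `S`. -/
def Copula.knockoffCov (c : Copula p) (S : Fin p → ℝ) : Matrix (Fin p ⊕ Fin p) (Fin p ⊕ Fin p) ℝ :=
  Matrix.fromBlocks c.corr (c.corr - Matrix.diagonal S) (c.corr - Matrix.diagonal S) c.corr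

/-- Step 1: the conditional law of the underlying variables given the observed predictors
and the responses. -/
def Model.posterior {s : Study N p J} (Q : Model s) {i : Fin N} (x : s.Obs i) :
    Measure (Fin p → ℝ) :=
  let m := (Q.cop.fibreVec s x.1 x.2.1).withDensity fun t =>
    ENNReal.ofReal (gaussDensity Q.cop.corr t * Q.resp x.2.2 (Q.cop.transVec s t))
  (m Set.univ)⁻¹ • m

/-- Step 2: the conditional law of the underlying variables of the knockoffs given those of
the predictors, when both together are normal with covariance matrix `G`. -/
def Copula.knockoffStep (c : Copula p) (S : Fin p → ℝ) (t : Fin p → ℝ) : Measure (Fin p → ℝ) :=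
  (volume : Measure (Fin p → ℝ)).withDensity fun t' =>
    ENNReal.ofReal (gaussDensity (c.knockoffCov S) (Sum.elim t t') / gaussDensity c.corr t)

/-- Steps 1 to 3: the law of the knockoff copy of the observed predictors of student `i`. -/
def Model.knockoffLaw {s : Study N p J} (Q : Model s) (S : Fin p → ℝ) {i : Fin N} (x : s.Obs i) :
    Measure (Fin p → ℝ) :=
  ((Q.posterior x).bind (Q.cop.knockoffStep S)).map fun t' => mask x.1 (Q.cop.transVec s t')

/-- The joint law of the observed data of all students and their knockoffs from `M` runs: the
students are independent; the observed data follow the true model `P`; given the data, the runs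
are independent and generate the knockoffs under the plug-in model `Q`. -/
def studyLaw {s : Study N p J} (P Q : Model s) (S : Fin p → ℝ)
    (q : Fin N → Finset (Fin p) → (Fin p → ℝ) → ℝ) (M : ℕ) :
    Measure ((i : Fin N) → s.Obs i × (Fin M → Fin p → ℝ)) :=
  Measure.pi fun i => (P.obsLaw q i).bind fun x =>
    (Measure.pi fun _ : Fin M => Q.knockoffLaw S x).map (Prod.mk x)

/-! ### Knockoff statistics -/

/-- Swap the predictors in `T` with their knockoffs, where they are observed. -/
def swapPair {s : Study N p J} (T : Finset (Fin p)) (d : (i : Fin N) → s.PairObs i) :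
    (i : Fin N) → s.PairObs i := fun i =>
  (((d i).1.1, fun j => if j ∈ T ∧ j ∈ (d i).1.1 then (d i).2 j else (d i).1.2.1 j, (d i).1.2.2),
    fun j => if j ∈ T ∧ j ∈ (d i).1.1 then (d i).1.2.1 j else (d i).2 j)

/-- The flip-sign property, which defines knockoff statistics. -/
def FlipSign {s : Study N p J} (w : ((i : Fin N) → s.PairObs i) → Fin p → ℝ) : Prop :=
  ∀ (T : Finset (Fin p)) (d : (i : Fin N) → s.PairObs i) (j : Fin p),
    w (swapPair T d) j = if j ∈ T then -w d j else w d j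

/-- Parameters of the structural model extended by the knockoff variables. -/
structure ExtParam (s : Study N p J) where
  intercept : ℝ
  β : s.Slopes
  γ : s.Slopes
  resVar : ℝ≥0

/-- Joint density of observed predictors `z_j`, knockoffs `z'_j`, `j ∈ A`, and responses `y`
in the extended latent regression model. -/
def Copula.extDensity (c : Copula p) (s : Study N p J) (S : Fin p → ℝ) (θ : ExtParam s)
    {i : Fin N} (A : Finset (Fin p)) (z z' : Fin p → ℝ) (y : s.Resp i) : ℝ :=
  ∫ u, gaussDensity (c.knockoffCov S) (Sum.elim u.1 u.2) *
      s.respProb y (θ.intercept + s.linPred θ.β (c.transVec s u.1) +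
        s.linPred θ.γ (c.transVec s u.2)) θ.resVar
    ∂((c.fibreVec s A z).prod (c.fibreVec s A z'))

/-- The log-likelihood of the extended latent regression model. -/
def Copula.extLogLik (c : Copula p) (s : Study N p J) (S : Fin p → ℝ)
    (d : (i : Fin N) → s.PairObs i) (θ : ExtParam s) : ℝ :=
  ∑ i, Real.log (c.extDensity s S θ (d i).1.1 (d i).1.2.1 (d i).2 (d i).1.2.2)

/-- `θ` is a maximum likelihood estimate. -/
def Copula.IsMLE (c : Copula p) (s : Study N p J) (S : Fin p → ℝ)
    (d : (i : Fin N) → s.PairObs i) (θ : ExtParam s) : Prop :=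
  0 < θ.resVar ∧ ∀ θ' : ExtParam s, 0 < θ'.resVar → c.extLogLik s S d θ' ≤ c.extLogLik s S d θ

/-- The covariance matrix of `g_j(Z_j)` in the Gaussian copula model. -/
def Copula.featureCov (c : Copula p) (s : Study N p J) (j : Fin p) :
    Matrix (Fin (s.kind j).dim) (Fin (s.kind j).dim) ℝ :=
  fun k l => cov[fun t => (s.kind j).feature k (c.trans s j t),
    fun t => (s.kind j).feature l (c.trans s j t); gaussianReal 0 1]

/-- The Euclidean norm of the standardised coefficient `Cov(g_j(Z_j))^{1/2} b`, that is, the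
square root of `bᵀ Cov(g_j(Z_j)) b`. -/
def Copula.stdNorm (c : Copula p) (s : Study N p J) (j : Fin p)
    (b : Fin (s.kind j).dim → ℝ) : ℝ :=
  Real.sqrt (b ⬝ᵥ ((c.featureCov s j).mulVec b))

/-- The likelihood-based knockoff statistics; they are set to `0` for data for which there
is no unique maximum likelihood estimate. -/
def Copula.likStat (c : Copula p) (s : Study N p J) (S : Fin p → ℝ)
    (d : (i : Fin N) → s.PairObs i) (j : Fin p) : ℝ :=
  open Classical in
  if h : ∃! θ : ExtParam s, c.IsMLE s S d θ then
    let nβ := c.stdNorm s j (h.choose.β j)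
    let nγ := c.stdNorm s j (h.choose.γ j)
    Real.sign (nβ - nγ) *
      max (nβ / Real.sqrt (s.kind j).dim) (nγ / Real.sqrt (s.kind j).dim)
  else 0

/-! ### Selection procedures -/

/-- `1 + |{j : W_j < -t}|`. -/
def negCount (W : Fin p → ℝ) (t : ℝ) : ℕ :=
  open Classical in 1 + (Finset.univ.filter fun j => W j < -t).card

/-- The threshold `τ = inf {t > 0 : 1 + |{j : W_j < -t}| = ν}`. When no `t` gives equality
(fewer than `ν - 1` negative statistics, or a jump over `ν` because of ties), the condition is
`1 + |{j : W_j < -t}| ≤ ν` instead; the two infima agree whenever the first set is non-empty. -/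
def threshold (ν : ℕ) (W : Fin p → ℝ) : ℝ :=
  open Classical in
  if {t : ℝ | 0 < t ∧ negCount W t = ν}.Nonempty then sInf {t : ℝ | 0 < t ∧ negCount W t = ν}
  else sInf {t : ℝ | 0 < t ∧ negCount W t ≤ ν}

/-- The baseline selection `{j : W_j > τ}`. -/
def baseline (ν : ℕ) (W : Fin p → ℝ) : Finset (Fin p) :=
  open Classical in Finset.univ.filter fun j => threshold ν W < W j

/-- The selection frequency of `j` in the selections `Sel m`, `m = 1, …, M`. -/
def frequency {M : ℕ} (Sel : Fin M → Finset (Fin p)) (j : Fin p) : ℝ :=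
  (∑ m, if j ∈ Sel m then (1 : ℝ) else 0) / M

/-- The derandomised selection: the predictors with selection frequency at least `η`. -/
def derandomised {M : ℕ} (η : ℝ) (Sel : Fin M → Finset (Fin p)) : Finset (Fin p) :=
  open Classical in Finset.univ.filter fun j => η ≤ frequency Sel j

/-! ### Observed Kullback-Leibler divergence -/

/-- Conditional density of predictor `j` at `x` given the other observed predictors and the
responses, for `j ∈ A`. -/
def Model.condDensity {s : Study N p J} (P : Model s) {i : Fin N} (A : Finset (Fin p)) (j : Fin p)
    (x : ℝ) (z : Fin p → ℝ) (y : s.Resp i) : ℝ :=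
  P.obsDensity A (Function.update z j x) y / P.obsDensity (A.erase j) z y

/-- Conditional density of the knockoff copy `z'` given the observed predictors `z` and the
responses. In the model, the responses do not depend on the knockoffs given the predictors. -/
def Model.knockoffDensity {s : Study N p J} (Q : Model s) (S : Fin p → ℝ) {i : Fin N}
    (A : Finset (Fin p)) (z' z : Fin p → ℝ) (y : s.Resp i) : ℝ :=
  Q.cop.extDensity s S ⟨Q.intercept, Q.slope, 0, Q.resVar⟩ A z z' y / Q.obsDensity A z y

/-- The observed Kullback-Leibler divergence of predictor `j` between the true model `P` and
the plug-in model `Q`. -/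
def KLhat {s : Study N p J} (P Q : Model s) (S : Fin p → ℝ) (j : Fin p)
    (d : (i : Fin N) → s.PairObs i) : ℝ :=
  ∑ i, if j ∈ (d i).1.1 then
    let A := (d i).1.1
    let z := (d i).1.2.1
    let y := (d i).1.2.2
    let z' := (d i).2
    Real.log
      ((P.condDensity A j (z j) z y * Q.knockoffDensity S A z' z y) /
        (P.condDensity A j (z' j) z y *
          Q.knockoffDensity S A (Function.update z' j (z j)) (Function.update z j (z' j)) y))
  else 0

/-! ### The derandomised procedure on random data -/

section Procedure

variable {Ω : Type*} {s : Study N p J} {M : ℕ}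

/-- The data of run `m`: observed data and the knockoffs of that run. -/
def runData (X : (i : Fin N) → Ω → s.Obs i) (Z : Fin M → Fin N → Ω → Fin p → ℝ)
    (m : Fin M) (ω : Ω) : (i : Fin N) → s.PairObs i := fun i => (X i ω, Z m i ω)

/-- The selections of all runs with the knockoff statistics `w`. -/
def runSel (w : ((i : Fin N) → s.PairObs i) → Fin p → ℝ) (ν : ℕ)
    (X : (i : Fin N) → Ω → s.Obs i) (Z : Fin M → Fin N → Ω → Fin p → ℝ) (ω : Ω) :
    Fin M → Finset (Fin p) := fun m => baseline ν (w (runData X Z m ω))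

/-- `Π_j^†`: the proportion of runs that select `j` with observed divergence at most `ε`. -/
def PiDagger (P Q : Model s) (S : Fin p → ℝ) (w : ((i : Fin N) → s.PairObs i) → Fin p → ℝ)
    (ν : ℕ) (ε : ℝ) (X : (i : Fin N) → Ω → s.Obs i) (Z : Fin M → Fin N → Ω → Fin p → ℝ)
    (j : Fin p) (ω : Ω) : ℝ :=
  open Classical in
  (∑ m, if j ∈ runSel w ν X Z ω m ∧ KLhat P Q S j (runData X Z m ω) ≤ ε then (1 : ℝ) else 0) / M

/-- The selected null predictors whose observed divergence is at most `ε` in all runs. -/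
def selectedNulls (P Q : Model s) (S : Fin p → ℝ)
    (w : ((i : Fin N) → s.PairObs i) → Fin p → ℝ) (ν : ℕ) (η ε : ℝ)
    (X : (i : Fin N) → Ω → s.Obs i) (Z : Fin M → Fin N → Ω → Fin p → ℝ) (ω : Ω) :
    Finset (Fin p) :=
  open Classical in
  (derandomised η (runSel w ν X Z ω) \ P.nonnull).filter fun j =>
    ∀ m, KLhat P Q S j (runData X Z m ω) ≤ ε

end Procedure

end LatentKnockoff

end

open LatentKnockoff

noncomputable section

namespace LatentKnockoff

/-! ### Product measures -/

section ProductMeasure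

/-! For a single run, the observed data and knockoffs of one student have the density `pairDensity`:
the true density of observed predictors and responses, times the missingness probability, times the
knockoff density under the plug-in model. The reference measure is a product that does not change
when $z_j$ and its knockoff are exchanged. For a null $j$, SMAR makes the missingness factor blind
to the exchange, so the ratio of the density to its exchanged version is exactly the exponential of
the student's term of the observed divergence (`pairDensity_eq_exp_klTerm_mul`). Multiplying over
the independent students, the law $L$ of one run has density $\exp(\widehat{\rm KL}_j)$ with respect
to its own image under the exchange. Hence $L(B\cap\{\widehat{\rm KL}_j\le\epsilon\})\le e^\epsilon
L(\mathrm{swap}_j^{-1}B)$ for every event $B$ (`pi_pairLaw_inter_le`).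

Take for $B$ the event that $j$ is selected. By the flip-sign property the exchange merely reverses
the sign of $W_j$, so it remains to count, for a fixed vector $W$, the indices $j$ that would be
selected if the sign of $W_j$ alone were reversed. There are at most $\nu$ of them
(`card_mem_baseline_neg_le`), and summing over null $j$ gives $\nu e^\epsilon$ for one run. The
likelihood-based statistics are covered because the extended model is invariant under a joint
exchange of predictors, knockoffs and their slopes (`flipSign_likStat`).

Derandomisation needs only linearity of expectation. If the divergence is at most $\epsilon$ in all
runs, then $\Pi_j=\Pi_j^\dagger$; the hypothesis bounds $\mathbb P(\Pi_j^\dagger\ge\eta)$ by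
$\mathbb E[\Pi_j^\dagger]$, an average of single-run probabilities, so dependence between runs is
irrelevant. Part (2) compares the atoms $k/31$ and $(31-k)/31$ in pairs.

The analytic work lies in establishing the densities. Observed predictors mix continuous, discrete
and missing coordinates, and `Copula.Valid.lintegral_fibreVec` disintegrates Lebesgue measure of the
underlying vector along them. -/

theorem lintegral_fin_pi_prod {n : ℕ} {E : Fin n → Type*} {mE : ∀ i, MeasurableSpace (E i)}
    {μ : (i : Fin n) → Measure (E i)} [∀ i, SigmaFinite (μ i)]
    {f : (i : Fin n) → E i → ℝ≥0∞} (hf : ∀ i, Measurable (f i)) :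
    ∫⁻ x, ∏ i, f i (x i) ∂(Measure.pi μ) = ∏ i, ∫⁻ x, f i x ∂(μ i) := by
  induction n with
  | zero => simp
  | succ n ih =>
    have hm : Measurable fun x : (i : Fin n) → E i.succ => ∏ i : Fin n, f i.succ (x i) :=
      Finset.measurable_prod _ fun i _ => (hf i.succ).comp (measurable_pi_apply i)
    have h := (measurePreserving_piFinSuccAbove μ 0).lintegral_comp
      (((hf 0).comp measurable_fst).mul (hm.comp measurable_snd))
    have h' := lintegral_prod_mul (μ := μ 0) (ν := Measure.pi fun i : Fin n => μ i.succ)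
      (hf 0).aemeasurable hm.aemeasurable
    rw [ih fun i => hf _] at h'
    rw [Fin.prod_univ_succ, ← h']
    refine Eq.trans (lintegral_congr fun x => ?_) h
    rw [Fin.prod_univ_succ]
    rfl

theorem lintegral_pi_prod {ι : Type*} [Fintype ι] {E : ι → Type*}
    {mE : ∀ i, MeasurableSpace (E i)} {μ : (i : ι) → Measure (E i)} [∀ i, SigmaFinite (μ i)]
    {f : (i : ι) → E i → ℝ≥0∞} (hf : ∀ i, Measurable (f i)) :
    ∫⁻ x, ∏ i, f i (x i) ∂(Measure.pi μ) = ∏ i, ∫⁻ x, f i x ∂(μ i) := by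
  let e := (Fintype.equivFin ι).symm
  rw [← (measurePreserving_piCongrLeft _ e).lintegral_comp_emb
    (MeasurableEquiv.measurableEmbedding _)]
  simp_rw [← e.prod_comp, MeasurableEquiv.coe_piCongrLeft, Equiv.piCongrLeft_apply_apply]
  exact lintegral_fin_pi_prod fun i => hf _

/-- Serves to multiply the change of measure of one student over all students. -/
theorem pi_withDensity {ι : Type*} [Fintype ι] {E : ι → Type*}
    {mE : ∀ i, MeasurableSpace (E i)} {μ : (i : ι) → Measure (E i)} [∀ i, SigmaFinite (μ i)]
    {f : (i : ι) → E i → ℝ≥0∞} (hf : ∀ i, Measurable (f i))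
    [∀ i, SigmaFinite ((μ i).withDensity (f i))] :
    Measure.pi (fun i => (μ i).withDensity (f i)) =
      (Measure.pi μ).withDensity fun x => ∏ i, f i (x i) := by
  refine Measure.pi_eq fun s hs => ?_
  rw [withDensity_apply _ (.univ_pi hs), Measure.restrict_pi_pi, lintegral_pi_prod hf]
  exact Finset.prod_congr rfl fun i _ => (withDensity_apply _ (hs i)).symm

theorem measurable_pi_measure {ι α : Type*} [Fintype ι] [MeasurableSpace α] {E : ι → Type*}
    [∀ i, MeasurableSpace (E i)] {κ : (i : ι) → α → Measure (E i)}
    [∀ i a, IsFiniteMeasure (κ i a)] (hκ : ∀ i, Measurable (κ i)) :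
    Measurable fun a => Measure.pi fun i => κ i a := by
  refine Measurable.measure_of_isPiSystem generateFrom_pi.symm isPiSystem_pi ?_ ?_
  · rintro _ ⟨s, hs, rfl⟩
    simp_rw [Measure.pi_pi]
    exact Finset.measurable_prod _ fun i _ =>
      Measure.measurable_measure.1 (hκ i) _ (hs i (Set.mem_univ i))
  · simp_rw [Measure.pi_univ]
    exact Finset.measurable_prod _ fun i _ =>
      Measure.measurable_measure.1 (hκ i) _ MeasurableSet.univ

/-- Exchange the coordinates in `T` of two vectors. -/
def swapCoord {ι : Type*} [DecidableEq ι] (T : Finset ι) (u : (ι → ℝ) × (ι → ℝ)) :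
    (ι → ℝ) × (ι → ℝ) :=
  (fun j => if j ∈ T then u.2 j else u.1 j, fun j => if j ∈ T then u.1 j else u.2 j)

variable {ι : Type*} [DecidableEq ι]

@[simp]
theorem swapCoord_swapCoord (T : Finset ι) (u : (ι → ℝ) × (ι → ℝ)) :
    swapCoord T (swapCoord T u) = u := by
  ext j <;> simp only [swapCoord] <;> split_ifs <;> rfl

theorem measurable_swapCoord (T : Finset ι) : Measurable (swapCoord T) := by
  refine Measurable.prodMk (measurable_pi_lambda _ fun j => ?_)
    (measurable_pi_lambda _ fun j => ?_) <;> split_ifs <;> fun_prop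

theorem swapCoord_singleton (j : ι) (x y : ι → ℝ) :
    swapCoord {j} (x, y) = (Function.update x j (y j), Function.update y j (x j)) := by
  ext k <;> by_cases h : k = j <;> simp [swapCoord, h]

variable [Fintype ι]

/-- Viewed as a vector of pairs, the exchange acts on each coordinate separately, as `Prod.swap` or
the identity. Equal families give the invariance of the reference measure; distinct families are
needed for the fibres in the extended likelihood. -/
theorem measurePreserving_swapCoord (T : Finset ι) (μ ν : ι → Measure ℝ)
    [∀ i, SigmaFinite (μ i)] [∀ i, SigmaFinite (ν i)] :
    MeasurePreserving (swapCoord T) ((Measure.pi μ).prod (Measure.pi ν))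
      ((Measure.pi fun j => if j ∈ T then ν j else μ j).prod
        (Measure.pi fun j => if j ∈ T then μ j else ν j)) := by
  have h1 : ∀ j, SigmaFinite (if j ∈ T then ν j else μ j) := fun j => by
    split_ifs <;> infer_instance
  have h2 : ∀ j, SigmaFinite (if j ∈ T then μ j else ν j) := fun j => by
    split_ifs <;> infer_instance
  have h3 : MeasurePreserving
      (fun (x : ι → ℝ × ℝ) j => (if j ∈ T then Prod.swap else id : ℝ × ℝ → ℝ × ℝ) (x j))
      (Measure.pi fun j => (μ j).prod (ν j))
      (Measure.pi fun j => (if j ∈ T then ν j else μ j).prod (if j ∈ T then μ j else ν j)) := by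
    refine measurePreserving_pi _ _ fun j => ?_
    by_cases hj : j ∈ T
    · simp only [hj, if_true]
      exact Measure.measurePreserving_swap
    · simp only [hj, if_false]
      exact MeasurePreserving.id _
  have h4 := (measurePreserving_arrowProdEquivProdArrow ℝ ℝ ι _ _).comp
    (h3.comp (measurePreserving_arrowProdEquivProdArrow ℝ ℝ ι μ ν).symm)
  convert h4 using 1
  ext u j <;> simp only [swapCoord, MeasurableEquiv.arrowProdEquivProdArrow,
    Equiv.arrowProdEquivProdArrow, Function.comp, MeasurableEquiv.symm_mk, MeasurableEquiv.coe_mk,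
    Equiv.coe_fn_symm_mk, Equiv.coe_fn_mk] <;> split_ifs <;> rfl

end ProductMeasure

/-! ### The multivariate normal density -/

section Gaussian

variable {ι : Type} [Fintype ι] [DecidableEq ι]

open scoped Matrix

theorem measurable_gaussDensity (S : Matrix ι ι ℝ) : Measurable (gaussDensity S) := by
  have : Continuous (gaussDensity S) := by
    unfold gaussDensity
    refine continuous_const.mul (Real.continuous_exp.comp ?_)
    refine (Continuous.neg ?_).div_const 2
    exact continuous_id.dotProduct (Continuous.matrix_mulVec continuous_const continuous_id)
  exact this.measurable

theorem gaussDensity_pos {S : Matrix ι ι ℝ} (hS : S.PosDef) (x : ι → ℝ) :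
    0 < gaussDensity S x := by
  have := hS.det_pos
  unfold gaussDensity
  positivity

open scoped MatrixOrder Matrix.Norms.L2Operator in
-- In the coordinates $Cx$ the density is a product of standard normal densities; both the
-- normalisation and the tail bound come from this.
theorem exists_inv_eq_transpose_mul_self {S : Matrix ι ι ℝ} (hS : S.PosDef) :
    ∃ C : Matrix ι ι ℝ, C.det ≠ 0 ∧ S⁻¹ = Cᵀ * C := by
  obtain ⟨C, hC⟩ := CStarAlgebra.nonneg_iff_eq_star_mul_self.mp hS.inv.posSemidef.nonneg
  refine ⟨C, fun h => ?_, by simpa [Matrix.star_eq_conjTranspose] using hC⟩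
  have := hS.inv.det_pos
  rw [hC, Matrix.det_mul, h, mul_zero] at this
  exact this.false

theorem dotProduct_inv_mulVec {S C : Matrix ι ι ℝ} (h : S⁻¹ = Cᵀ * C) (x : ι → ℝ) :
    x ⬝ᵥ S⁻¹ *ᵥ x = ∑ j, (C *ᵥ x) j ^ 2 := by
  rw [h, ← Matrix.mulVec_mulVec, Matrix.dotProduct_mulVec, Matrix.vecMul_transpose, dotProduct]
  simp_rw [sq]

theorem gaussDensity_eq_prod {S C : Matrix ι ι ℝ} (hS : S.PosDef) (h : S⁻¹ = Cᵀ * C)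
    (x : ι → ℝ) :
    gaussDensity S x = |C.det| * ∏ j, gaussianPDFReal 0 1 ((C *ᵥ x) j) := by
  have hd : S.det = (|C.det| ^ 2)⁻¹ := by
    have h1 := Matrix.det_nonsing_inv_mul_det S hS.det_pos.ne'.isUnit
    rw [h, Matrix.det_mul, Matrix.det_transpose, ← sq, ← sq_abs] at h1
    exact eq_inv_of_mul_eq_one_right h1
  have h1 : Real.sqrt ((2 * Real.pi) ^ Fintype.card ι * S.det) =
      Real.sqrt (2 * Real.pi) ^ Fintype.card ι * |C.det|⁻¹ := by
    rw [hd, Real.sqrt_mul (by positivity), Real.sqrt_inv, Real.sqrt_sq (abs_nonneg _)]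
    have h2 : (2 * Real.pi) ^ Fintype.card ι = (Real.sqrt (2 * Real.pi) ^ Fintype.card ι) ^ 2 := by
      rw [← pow_mul, mul_comm _ 2, pow_mul, Real.sq_sqrt (by positivity)]
    rw [h2, Real.sqrt_sq (by positivity)]
  simp only [gaussDensity, gaussianPDFReal, dotProduct_inv_mulVec h, h1]
  rw [Finset.prod_mul_distrib, ← Real.exp_sum, Finset.prod_const, Finset.card_univ]
  simp only [NNReal.coe_one, mul_one, sub_zero, mul_inv, inv_inv, inv_pow, neg_div,
    Finset.sum_neg_distrib, Finset.sum_div]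
  ring

theorem lintegral_gaussDensity {S : Matrix ι ι ℝ} (hS : S.PosDef) :
    ∫⁻ x, ENNReal.ofReal (gaussDensity S x) = 1 := by
  obtain ⟨C, hC, h⟩ := exists_inv_eq_transpose_mul_self hS
  have hm : Measurable fun x : ι → ℝ => ∏ j, ENNReal.ofReal (gaussianPDFReal 0 1 (x j)) :=
    Finset.measurable_prod _ fun j _ =>
      ((measurable_gaussianPDFReal 0 1).comp (measurable_pi_apply j)).ennreal_ofReal
  have h1 : ∀ x, ENNReal.ofReal (gaussDensity S x) = ENNReal.ofReal |C.det| *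
      ∏ j, ENNReal.ofReal (gaussianPDFReal 0 1 (Matrix.toLin' C x j)) := fun x => by
    rw [gaussDensity_eq_prod hS h, ENNReal.ofReal_mul (abs_nonneg _),
      ENNReal.ofReal_prod_of_nonneg fun _ _ => gaussianPDFReal_nonneg _ _ _]
    simp
  have hl : Measurable (Matrix.toLin' C) :=
    (LinearMap.continuous_of_finiteDimensional (Matrix.toLin' C)).measurable
  have h2 := lintegral_map (μ := volume) hm hl
  -- The image of Lebesgue measure under $C$ carries the factor $|\det C|^{-1}$, which cancels the
  -- $|\det C|$ of the density.
  rw [Real.map_matrix_volume_pi_eq_smul_volume_pi hC, lintegral_smul_measure, volume_pi,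
    lintegral_pi_prod (fun _ => (measurable_gaussianPDFReal 0 1).ennreal_ofReal)] at h2
  simp_rw [h1]
  have h3 := lintegral_const_mul (μ := volume) (ENNReal.ofReal |C.det|) (hm.comp hl)
  simp only [Function.comp_apply] at h3
  rw [h3, volume_pi, ← h2]
  simp only [lintegral_gaussianPDFReal_eq_one 0 one_ne_zero, Finset.prod_const_one, smul_eq_mul,
    mul_one]
  rw [← ENNReal.ofReal_mul (abs_nonneg _), ← abs_mul, mul_inv_cancel₀ hC, abs_one,
    ENNReal.ofReal_one]

/-- By Cauchy-Schwarz, $\|x\|^2\le D\|Cx\|^2$ with $D$ the squared Frobenius norm of $C^{-1}$. The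
bound has product form so that integrability against products of point masses and Lebesgue measures
can be checked coordinatewise. -/
theorem exists_gaussDensity_le {S : Matrix ι ι ℝ} (hS : S.PosDef) :
    ∃ K c : ℝ, 0 < c ∧ ∀ x, gaussDensity S x ≤ K * ∏ j, Real.exp (-c * x j ^ 2) := by
  obtain ⟨C, hC, h⟩ := exists_inv_eq_transpose_mul_self hS
  have hu : IsUnit C.det := hC.isUnit
  set D : ℝ := ∑ j, ∑ k, C⁻¹ j k ^ 2 with hD
  have hD0 : 0 ≤ D := Finset.sum_nonneg fun _ _ => Finset.sum_nonneg fun _ _ => sq_nonneg _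
  have key : ∀ x : ι → ℝ, ∑ j, x j ^ 2 ≤ D * ∑ k, (C *ᵥ x) k ^ 2 := fun x => by
    rw [hD, Finset.sum_mul]
    refine Finset.sum_le_sum fun j _ => ?_
    have hx : x j = ∑ k, C⁻¹ j k * (C *ᵥ x) k := by
      have : C⁻¹ *ᵥ (C *ᵥ x) = x := by
        rw [Matrix.mulVec_mulVec, Matrix.nonsing_inv_mul _ hu, Matrix.one_mulVec]
      exact (congrFun this j).symm
    conv_lhs => rw [hx]
    exact Finset.sum_mul_sq_le_sq_mul_sq _ _ _
  -- $D+1$ instead of $D$, since $D=0$ for an empty index type.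
  refine ⟨(Real.sqrt ((2 * Real.pi) ^ Fintype.card ι * S.det))⁻¹, (2 * (D + 1))⁻¹, by positivity,
    fun x => ?_⟩
  rw [← Real.exp_sum, gaussDensity, dotProduct_inv_mulVec h]
  refine mul_le_mul_of_nonneg_left (Real.exp_le_exp.2 ?_) (by positivity)
  have h0 : 0 ≤ ∑ k, (C *ᵥ x) k ^ 2 := Finset.sum_nonneg fun _ _ => sq_nonneg _
  have h1 : ∑ j, x j ^ 2 ≤ (D + 1) * ∑ k, (C *ᵥ x) k ^ 2 := by linarith [key x]
  rw [← Finset.mul_sum, mul_inv, neg_div, neg_mul, neg_le_neg_iff]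
  have h2 : (D + 1)⁻¹ * ∑ j, x j ^ 2 ≤ ∑ k, (C *ᵥ x) k ^ 2 := by
    rw [inv_mul_le_iff₀ (by positivity)]
    exact h1
  linarith

theorem gaussDensity_comp_equiv {S : Matrix ι ι ℝ} (e : ι ≃ ι) (he : S.submatrix e e = S)
    (x : ι → ℝ) : gaussDensity S (x ∘ e) = gaussDensity S x := by
  have h : S⁻¹ = S⁻¹.submatrix e e := by
    conv_lhs => rw [← he, Matrix.inv_submatrix_equiv]
  have : (x ∘ e) ⬝ᵥ S⁻¹ *ᵥ (x ∘ e) = x ⬝ᵥ S⁻¹ *ᵥ x := by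
    conv_lhs => rw [h]
    rw [Matrix.submatrix_mulVec_equiv]
    simp [Function.comp_assoc]
  simp only [gaussDensity, this]

/-! ### Block covariance matrices: marginal and conditional normal densities -/

variable {κ : Type} [Fintype κ] [DecidableEq κ]

theorem posDef_schur {A : Matrix ι ι ℝ} {B : Matrix ι κ ℝ} {D : Matrix κ κ ℝ}
    (hG : (Matrix.fromBlocks A B Bᵀ D).PosDef) (hA : A.PosDef) :
    (D - Bᵀ * A⁻¹ * B).PosDef := by
  let _ : Invertible A := hA.isUnit.invertible
  have h1 : (D - Bᵀ * A⁻¹ * B).PosSemidef := by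
    have := (Matrix.PosDef.fromBlocks₁₁ B D hA).1 (by simpa using hG.posSemidef)
    simpa using this
  refine h1.posDef_iff_det_ne_zero.2 fun h => ?_
  have := hG.det_pos
  rw [Matrix.det_fromBlocks₁₁, Matrix.invOf_eq_nonsing_inv, h, mul_zero] at this
  exact this.false

/-- Block elimination splits the quadratic form into that of $t$ and that of the residual
$v=t'-B^\top A^{-1}t$, and splits the determinant accordingly: marginal times conditional density.
-/
theorem gaussDensity_fromBlocks {A : Matrix ι ι ℝ} {B : Matrix ι κ ℝ} {D : Matrix κ κ ℝ}
    (hG : (Matrix.fromBlocks A B Bᵀ D).PosDef) (hA : A.PosDef) (t : ι → ℝ) (t' : κ → ℝ) :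
    gaussDensity (Matrix.fromBlocks A B Bᵀ D) (Sum.elim t t') =
      gaussDensity A t * gaussDensity (D - Bᵀ * A⁻¹ * B) (t' - Bᵀ *ᵥ (A⁻¹ *ᵥ t)) := by
  let _ : Invertible A := hA.isUnit.invertible
  have hS := posDef_schur hG hA
  have hAu : IsUnit A.det := hA.det_pos.ne'.isUnit
  have hGu : IsUnit (Matrix.fromBlocks A B Bᵀ D).det := hG.det_pos.ne'.isUnit
  have hAt : A⁻¹ᵀ = A⁻¹ := by simpa using hA.inv.isHermitian.eq
  set E := D - Bᵀ * A⁻¹ * B with hE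
  have hEu : IsUnit E.det := hS.det_pos.ne'.isUnit
  set v := t' - Bᵀ *ᵥ (A⁻¹ *ᵥ t) with hv
  have hdet : (Matrix.fromBlocks A B Bᵀ D).det = A.det * E.det := by
    rw [Matrix.det_fromBlocks₁₁, Matrix.invOf_eq_nonsing_inv]
  -- The solution of the block system found by elimination; it is verified by multiplying back.
  have hinv : (Matrix.fromBlocks A B Bᵀ D)⁻¹ *ᵥ (Sum.elim t t') =
      Sum.elim (A⁻¹ *ᵥ t - A⁻¹ *ᵥ (B *ᵥ (E⁻¹ *ᵥ v))) (E⁻¹ *ᵥ v) := by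
    have hw : E *ᵥ (E⁻¹ *ᵥ v) = v := by
      rw [Matrix.mulVec_mulVec, Matrix.mul_nonsing_inv _ hEu, Matrix.one_mulVec]
    have : (Matrix.fromBlocks A B Bᵀ D) *ᵥ
        (Sum.elim (A⁻¹ *ᵥ t - A⁻¹ *ᵥ (B *ᵥ (E⁻¹ *ᵥ v))) (E⁻¹ *ᵥ v)) = Sum.elim t t' := by
      rw [Matrix.fromBlocks_mulVec]
      congr 1
      · simp [Matrix.mulVec_sub, Matrix.mulVec_mulVec, Matrix.mul_nonsing_inv_cancel_left _ _ hAu,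
          Matrix.mul_nonsing_inv _ hAu]
      · rw [Sum.elim_comp_inl, Sum.elim_comp_inr]
        have h3 : D *ᵥ (E⁻¹ *ᵥ v) = v + Bᵀ *ᵥ (A⁻¹ *ᵥ (B *ᵥ (E⁻¹ *ᵥ v))) := by
          have : D = E + Bᵀ * A⁻¹ * B := by rw [hE]; abel
          conv_lhs => rw [this, Matrix.add_mulVec, hw]
          simp only [Matrix.mulVec_mulVec, Matrix.mul_assoc]
        rw [h3, Matrix.mulVec_sub, hv]
        abel
    rw [← this, Matrix.mulVec_mulVec, Matrix.nonsing_inv_mul _ hGu, Matrix.one_mulVec]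
  have hquad : (Sum.elim t t') ⬝ᵥ (Matrix.fromBlocks A B Bᵀ D)⁻¹ *ᵥ (Sum.elim t t') =
      t ⬝ᵥ A⁻¹ *ᵥ t + v ⬝ᵥ E⁻¹ *ᵥ v := by
    rw [hinv, sumElim_dotProduct_sumElim, dotProduct_sub]
    have : t ⬝ᵥ A⁻¹ *ᵥ (B *ᵥ (E⁻¹ *ᵥ v)) = (Bᵀ *ᵥ (A⁻¹ *ᵥ t)) ⬝ᵥ (E⁻¹ *ᵥ v) := by
      rw [Matrix.dotProduct_mulVec, Matrix.dotProduct_mulVec, Matrix.mulVec_transpose,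
        ← Matrix.mulVec_transpose A⁻¹, hAt]
    rw [this, hv, sub_dotProduct]
    ring
  rw [gaussDensity, gaussDensity, gaussDensity, hquad, hdet, Fintype.card_sum, pow_add,
    show (2 * Real.pi) ^ Fintype.card ι * (2 * Real.pi) ^ Fintype.card κ * (A.det * E.det) =
      ((2 * Real.pi) ^ Fintype.card ι * A.det) * ((2 * Real.pi) ^ Fintype.card κ * E.det) by ring,
    Real.sqrt_mul (mul_nonneg (by positivity) hA.det_pos.le), mul_inv, neg_add, add_div,
    Real.exp_add]
  ring

theorem lintegral_gaussDensity_fromBlocks {A : Matrix ι ι ℝ} {B : Matrix ι κ ℝ} {D : Matrix κ κ ℝ}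
    (hG : (Matrix.fromBlocks A B Bᵀ D).PosDef) (hA : A.PosDef) (t : ι → ℝ) :
    ∫⁻ t', ENNReal.ofReal
      (gaussDensity (Matrix.fromBlocks A B Bᵀ D) (Sum.elim t t') / gaussDensity A t) = 1 := by
  have h : ∀ t', gaussDensity (Matrix.fromBlocks A B Bᵀ D) (Sum.elim t t') / gaussDensity A t =
      gaussDensity (D - Bᵀ * A⁻¹ * B) (t' - Bᵀ *ᵥ (A⁻¹ *ᵥ t)) := fun t' => by
    rw [gaussDensity_fromBlocks hG hA, mul_div_cancel_left₀ _ (gaussDensity_pos hA t).ne']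
  simp_rw [h]
  rw [lintegral_sub_right_eq_self (μ := volume)
    (fun x => ENNReal.ofReal (gaussDensity (D - Bᵀ * A⁻¹ * B) x)) (Bᵀ *ᵥ (A⁻¹ *ᵥ t))]
  exact lintegral_gaussDensity (posDef_schur hG hA)

end Gaussian

/-! ### Disintegration of the underlying vector along the observed predictors -/

section Fibre

variable {N p J : ℕ}

/-- The reference measure for the values of a predictor. -/
def PredictorKind.base : PredictorKind → Measure ℝ
  | .continuous => volume
  | .categorical K => Measure.sum fun k : Fin (K + 1) => Measure.dirac (k : ℝ)

instance (k : PredictorKind) : SigmaFinite k.base := by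
  cases k <;> unfold PredictorKind.base <;> infer_instance

/-- The reference measure for coordinate `j` of the observed predictors. -/
def Study.baseAt (s : Study N p J) (A : Finset (Fin p)) (j : Fin p) : Measure ℝ :=
  if j ∈ A then (s.kind j).base else Measure.dirac 0

instance (s : Study N p J) (A : Finset (Fin p)) (j : Fin p) : SigmaFinite (s.baseAt A j) := by
  unfold Study.baseAt; split_ifs <;> infer_instance

/-- The reference measure for the observed predictors `z_j`, `j ∈ A`. -/
def Study.obsBase (s : Study N p J) (A : Finset (Fin p)) : Measure (Fin p → ℝ) :=
  Measure.pi (s.baseAt A)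

instance (s : Study N p J) (A : Finset (Fin p)) : SigmaFinite (s.obsBase A) := by
  unfold Study.obsBase; infer_instance

/-- The possible values of the observed predictors. -/
def Study.support (s : Study N p J) (A : Finset (Fin p)) : Set (Fin p → ℝ) :=
  {z | ∀ j ∈ A, ∀ K, s.kind j = .categorical K → ∃ k ≤ K, z j = (k : ℕ)}

/-- Densities are strictly positive on the support, and density ratios are used only there; this
makes that restriction harmless. -/
theorem Study.ae_mem_support (s : Study N p J) (A : Finset (Fin p)) :
    ∀ᵐ z ∂(s.obsBase A), z ∈ s.support A := by
  have h : ∀ j, ∀ᵐ (x : ℝ) ∂(s.baseAt A j),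
      j ∈ A → ∀ K, s.kind j = .categorical K → ∃ k ≤ K, x = (k : ℕ) := fun j => by
    by_cases hj : j ∈ A
    · cases hk : s.kind j with
      | continuous => simp
      | categorical K =>
        simp only [Study.baseAt, hj, if_true, hk, PredictorKind.base]
        rw [Measure.ae_sum_iff]
        intro k
        rw [ae_dirac_eq, Filter.eventually_pure]
        rintro - K' h
        cases h
        exact ⟨k, Nat.lt_succ_iff.1 k.2, rfl⟩
    · simp [hj]
  exact ae_all_iff.2 fun j => (Measure.quasiMeasurePreserving_eval (s.baseAt A) j).ae (h j)

theorem Study.mem_support_erase {s : Study N p J} {A : Finset (Fin p)} {z : Fin p → ℝ}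
    (hz : z ∈ s.support A) (j : Fin p) : z ∈ s.support (A.erase j) :=
  fun k hk => hz k (Finset.mem_of_mem_erase hk)

theorem Study.swapCoord_mem_support {s : Study N p J} {A : Finset (Fin p)} {u : (Fin p → ℝ) × (Fin p → ℝ)}
    (h1 : u.1 ∈ s.support A) (h2 : u.2 ∈ s.support A) (T : Finset (Fin p)) :
    (swapCoord T u).1 ∈ s.support A ∧ (swapCoord T u).2 ∈ s.support A := by
  refine ⟨fun j hj K hK => ?_, fun j hj K hK => ?_⟩ <;> simp only [swapCoord] <;> split_ifs
  exacts [h2 j hj K hK, h1 j hj K hK, h1 j hj K hK, h2 j hj K hK]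

/-! ### Fibres of the copula transformation as measurable kernels -/

variable (c : Copula p) (s : Study N p J)

/-- Coordinate `j` of `Copula.fibreVec`. -/
def Copula.fibreAt (A : Finset (Fin p)) (j : Fin p) (x : ℝ) : Measure ℝ :=
  if j ∈ A then c.fibre s j x else volume

theorem Copula.fibreVec_eq (A : Finset (Fin p)) (z : Fin p → ℝ) :
    c.fibreVec s A z = Measure.pi fun j => c.fibreAt s A j (z j) := rfl

instance (j : Fin p) (x : ℝ) : SigmaFinite (c.fibre s j x) := by
  unfold Copula.fibre
  split
  · have := Measure.smul_finite (Measure.dirac ((x - c.loc j) / c.scale j))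
      (c := ENNReal.ofReal (c.scale j)⁻¹) ENNReal.ofReal_ne_top
    infer_instance
  · infer_instance

instance (A : Finset (Fin p)) (j : Fin p) (x : ℝ) : SigmaFinite (c.fibreAt s A j x) := by
  unfold Copula.fibreAt; split_ifs <;> infer_instance

instance (A : Finset (Fin p)) (z : Fin p → ℝ) : SigmaFinite (c.fibreVec s A z) := by
  rw [Copula.fibreVec_eq]; infer_instance

theorem Copula.measurable_trans (j : Fin p) : Measurable (c.trans s j) := by
  unfold Copula.trans
  cases s.kind j with
  | continuous => fun_prop
  | categorical K =>
    simp only [Finset.card_filter, Nat.cast_sum]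
    refine Finset.measurable_sum _ fun k _ => ?_
    push_cast
    exact Measurable.ite measurableSet_Ioi measurable_const measurable_const

theorem Copula.measurable_transVec : Measurable (c.transVec s) :=
  measurable_pi_lambda _ fun j => (c.measurable_trans s j).comp (measurable_pi_apply j)

theorem measurable_mask (A : Finset (Fin p)) : Measurable (mask A) := by
  refine measurable_pi_lambda _ fun j => ?_
  unfold mask
  split_ifs <;> fun_prop

/-- Presents all fibres of a coordinate as weighted images of one fixed measure, with weight and map
jointly measurable. Measurability in the observed value $x$ is then immediate for point masses,
intervals and free coordinates alike. -/
theorem Copula.exists_fibreAt_eq (A : Finset (Fin p)) (j : Fin p) :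
    ∃ (ρ : Measure ℝ) (w : ℝ × ℝ → ℝ≥0∞) (ψ : ℝ × ℝ → ℝ), SigmaFinite ρ ∧ Measurable w ∧
      (∀ x, w x ≠ ∞) ∧ Measurable ψ ∧ ∀ x B, MeasurableSet B →
        c.fibreAt s A j x B = ∫⁻ u, w (x, u) * B.indicator 1 (ψ (x, u)) ∂ρ := by
  by_cases hj : j ∈ A
  · cases hk : s.kind j with
    | continuous =>
      refine ⟨Measure.dirac 0, fun _ => ENNReal.ofReal (c.scale j)⁻¹,
        fun x => (x.1 - c.loc j) / c.scale j, inferInstance, by fun_prop,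
        fun _ => ENNReal.ofReal_ne_top, by fun_prop, fun x B hB => ?_⟩
      simp [Copula.fibreAt, hj, Copula.fibre, hk, hB]
    | categorical K =>
      have hm : MeasurableSet {x : ℝ × ℝ | c.trans s j x.2 = x.1} :=
        measurableSet_eq_fun ((c.measurable_trans s j).comp measurable_snd) measurable_fst
      refine ⟨volume, {x : ℝ × ℝ | c.trans s j x.2 = x.1}.indicator 1, Prod.snd, inferInstance,
        measurable_one.indicator hm, fun x => ?_, measurable_snd, fun x B hB => ?_⟩
      · by_cases h : x ∈ {x : ℝ × ℝ | c.trans s j x.2 = x.1} <;> simp [h]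
      · have hm' : MeasurableSet {t | c.trans s j t = x} :=
          c.measurable_trans s j (measurableSet_singleton x)
        simp only [Copula.fibreAt, hj, Copula.fibre, hk, if_true]
        rw [Measure.restrict_apply hB, ← lintegral_indicator_one (hB.inter hm')]
        refine lintegral_congr fun u => ?_
        by_cases h1 : c.trans s j u = x <;> by_cases h2 : u ∈ B <;> simp [Set.indicator, h1, h2]
  · refine ⟨volume, 1, Prod.snd, inferInstance, measurable_one, by simp, measurable_snd,
      fun x B hB => ?_⟩
    simp [Copula.fibreAt, hj, lintegral_indicator_one hB]

/-- Multiplies the coordinatewise presentations. The fibre measures can be infinite, so s-finiteness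
is what permits composition products and Fubini. -/
theorem Copula.exists_kernel_eq_fibreVec (A : Finset (Fin p)) :
    ∃ K : Kernel (Fin p → ℝ) (Fin p → ℝ), IsSFiniteKernel K ∧ ∀ z, K z = c.fibreVec s A z := by
  choose ρ w ψ hρ hw hw' hψ h using c.exists_fibreAt_eq s A
  let W : (Fin p → ℝ) → (Fin p → ℝ) → ℝ≥0∞ := fun z u => ∏ j, w j (z j, u j)
  have hW : Measurable (Function.uncurry W) := by
    refine Finset.measurable_prod _ fun j _ => (hw j).comp ?_
    fun_prop
  let Ψ : (Fin p → ℝ) × (Fin p → ℝ) → Fin p → ℝ := fun x j => ψ j (x.1 j, x.2 j)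
  have hΨ : Measurable Ψ := measurable_pi_lambda _ fun j => (hψ j).comp (by fun_prop)
  have hs : IsSFiniteKernel ((Kernel.const (Fin p → ℝ) (Measure.pi ρ)).withDensity W) :=
    Kernel.IsSFiniteKernel.withDensity _ fun z u => ENNReal.prod_ne_top fun j _ => hw' j _
  refine ⟨(Kernel.id ×ₖ (Kernel.const (Fin p → ℝ) (Measure.pi ρ)).withDensity W).map Ψ,
    inferInstance, fun z => ?_⟩
  rw [Copula.fibreVec_eq]
  refine (Measure.pi_eq fun B hB => ?_).symm
  have hBm : MeasurableSet (Ψ ⁻¹' Set.univ.pi B) := hΨ (.univ_pi hB)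
  rw [Kernel.map_apply' _ hΨ _ (.univ_pi hB), Kernel.prod_apply, Kernel.id_apply,
    Measure.dirac_prod, Measure.map_apply measurable_prodMk_left hBm,
    Kernel.withDensity_apply' _ hW, Kernel.const_apply,
    ← lintegral_indicator (measurable_prodMk_left hBm)]
  simp_rw [h _ _ _ (hB _)]
  rw [← lintegral_pi_prod (f := fun j u => w j (z j, u) * (B j).indicator 1 (ψ j (z j, u)))
    fun j => ((hw j).comp measurable_prodMk_left).mul
      ((measurable_one.indicator (hB j)).comp ((hψ j).comp measurable_prodMk_left))]
  refine lintegral_congr fun u => ?_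
  rw [Finset.prod_mul_distrib]
  by_cases hu : ∀ j, ψ j (z j, u j) ∈ B j
  · rw [Set.indicator_of_mem (by simpa [Ψ] using hu)]
    simp [W, hu]
  · rw [Set.indicator_of_notMem (by simpa [Ψ] using hu)]
    obtain ⟨j, hj⟩ := not_forall.1 hu
    rw [Finset.prod_eq_zero (f := fun j => (B j).indicator (1 : ℝ → ℝ≥0∞) (ψ j (z j, u j)))
      (Finset.mem_univ j) (Set.indicator_of_notMem hj _), mul_zero]

theorem Copula.measurable_fibreVec (A : Finset (Fin p)) : Measurable (c.fibreVec s A) := by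
  obtain ⟨K, -, hK⟩ := c.exists_kernel_eq_fibreVec s A
  rw [← funext hK]
  exact K.measurable

/-- The kernel `z ↦ fibreVec s A z`. -/
def Copula.fibreKernel (A : Finset (Fin p)) : Kernel (Fin p → ℝ) (Fin p → ℝ) :=
  ⟨c.fibreVec s A, c.measurable_fibreVec s A⟩

@[simp]
theorem Copula.fibreKernel_apply (A : Finset (Fin p)) (z : Fin p → ℝ) :
    c.fibreKernel s A z = c.fibreVec s A z := rfl

instance (A : Finset (Fin p)) : IsSFiniteKernel (c.fibreKernel s A) := by
  obtain ⟨K, hK, h⟩ := c.exists_kernel_eq_fibreVec s A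
  rwa [show c.fibreKernel s A = K from Kernel.ext fun z => (h z).symm]

/-! ### Disintegration of Lebesgue measure, positivity of fibres, integrability -/

variable {c s}

/-- The recorded value of predictor `j` as a function of the underlying variable. -/
def Copula.maskTrans (c : Copula p) (s : Study N p J) (A : Finset (Fin p)) (j : Fin p) (t : ℝ) :
    ℝ :=
  if j ∈ A then c.trans s j t else 0

theorem Copula.measurable_maskTrans (A : Finset (Fin p)) (j : Fin p) :
    Measurable (c.maskTrans s A j) := by
  unfold Copula.maskTrans
  split_ifs
  exacts [c.measurable_trans s j, measurable_const]

/-- For a continuous predictor this is an affine change of variables, for a categorical one the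
partition of the line into the intervals of its categories, and for a missing one the recorded value
is constantly $0$. -/
theorem Copula.Valid.lintegral_fibreAt (hc : c.Valid s) (A : Finset (Fin p)) (j : Fin p)
    {B : Set (ℝ × ℝ)} (hB : MeasurableSet B) :
    ∫⁻ x, c.fibreAt s A j x (Prod.mk x ⁻¹' B) ∂(s.baseAt A j) =
      volume.map (fun t => (c.maskTrans s A j t, t)) B := by
  have hmt : Measurable fun t => (c.maskTrans s A j t, t) :=
    (Copula.measurable_maskTrans A j).prodMk measurable_id
  rw [Measure.map_apply hmt hB]
  by_cases hj : j ∈ A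
  · simp only [Copula.fibreAt, Study.baseAt, Copula.maskTrans, hj, if_true]
    cases hk : s.kind j with
    | continuous =>
      have hd := hc.scale_pos j hk
      simp only [Copula.fibre, hk, PredictorKind.base, Copula.trans]
      have hg : Measurable fun x : ℝ => B.indicator (1 : ℝ × ℝ → ℝ≥0∞) (x, (x - c.loc j) / c.scale j) :=
        (measurable_one.indicator hB).comp (by fun_prop)
      -- The Jacobian $d_j^{-1}$ is the mass placed on the fibre of a continuous predictor.
      have h1 : Measure.map (fun t : ℝ => c.loc j + c.scale j * t) volume =
          ENNReal.ofReal (c.scale j)⁻¹ • volume := by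
        have := Real.map_volume_mul_left hd.ne'
        rw [abs_of_pos (inv_pos.2 hd)] at this
        have h := Measure.map_map (μ := volume) (g := fun x => c.loc j + x)
          (f := fun t => c.scale j * t) (by fun_prop) (by fun_prop)
        rw [this, Measure.map_smul, map_add_left_eq_self] at h
        exact h.symm
      rw [← lintegral_indicator_one
        (((Measurable.prodMk (by fun_prop) measurable_id) : Measurable
          fun t : ℝ => (c.loc j + c.scale j * t, t)) hB)]
      have h2 := lintegral_map (μ := volume) hg
        (by fun_prop : Measurable fun t : ℝ => c.loc j + c.scale j * t)
      rw [h1, lintegral_smul_measure, smul_eq_mul, ← lintegral_const_mul _ hg] at h2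
      refine Eq.trans (lintegral_congr fun x => ?_) (h2.trans (lintegral_congr fun t => ?_))
      · rw [Measure.smul_apply, Measure.dirac_apply' _ (measurable_prodMk_left hB), smul_eq_mul]
        rfl
      · rw [show (c.loc j + c.scale j * t - c.loc j) / c.scale j = t by field_simp; ring]
        rfl
    | categorical K =>
      simp only [Copula.fibre, hk, PredictorKind.base]
      have hm : ∀ k : Fin (K + 1), MeasurableSet
          (Prod.mk (k : ℝ) ⁻¹' B ∩ {t | c.trans s j t = (k : ℝ)}) := fun k =>
        (measurable_prodMk_left hB).inter (c.measurable_trans s j (measurableSet_singleton _))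
      rw [lintegral_sum_measure, tsum_fintype]
      simp_rw [lintegral_dirac]
      simp_rw [Measure.restrict_apply (measurable_prodMk_left hB)]
      rw [← tsum_fintype (L := .unconditional _), ← measure_iUnion _ hm]
      · congr 1
        ext t
        simp only [Set.mem_iUnion, Set.mem_inter_iff, Set.mem_preimage, Set.mem_ofPred_eq]
        constructor
        · rintro ⟨k, h1, h2⟩
          rwa [h2]
        · intro h
          have hle : ((Finset.Icc 1 K).filter fun k => c.cut j k < t).card ≤ K :=
            (Finset.card_filter_le _ _).trans (by simp)
          have ht : c.trans s j t = ((((Finset.Icc 1 K).filter fun k => c.cut j k < t).card : ℕ) : ℝ) := by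
            simp only [Copula.trans, hk]
          refine ⟨⟨_, Nat.lt_succ_of_le hle⟩, ?_, ht⟩
          rwa [ht] at h
      · intro k l hkl
        refine Set.disjoint_left.2 fun t h1 h2 => hkl ?_
        have : (k : ℝ) = (l : ℝ) := h1.2.symm.trans h2.2
        exact Fin.ext (by exact_mod_cast this)
  · simp [Copula.fibreAt, Study.baseAt, Copula.maskTrans, hj]

/-- Both sides are integrals against a measure on pairs (recorded vector, underlying vector). On
boxes of $\prod_j\mathbb R^2$ these measures factor, and `Copula.Valid.lintegral_fibreAt` settles
each factor. -/
theorem Copula.Valid.lintegral_fibreVec (hc : c.Valid s) (A : Finset (Fin p))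
    {φ : (Fin p → ℝ) × (Fin p → ℝ) → ℝ≥0∞} (hφ : Measurable φ) :
    ∫⁻ z, ∫⁻ t, φ (z, t) ∂(c.fibreVec s A z) ∂(s.obsBase A) =
      ∫⁻ t, φ (mask A (c.transVec s t), t) := by
  let e := MeasurableEquiv.arrowProdEquivProdArrow ℝ ℝ (Fin p)
  have hm : ∀ j, Measurable fun t => (c.maskTrans s A j t, t) := fun j =>
    (Copula.measurable_maskTrans A j).prodMk measurable_id
  -- The second marginal is Lebesgue measure, hence σ-finite.
  have hσ : ∀ j, SigmaFinite ((volume : Measure ℝ).map fun t => (c.maskTrans s A j t, t)) :=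
    fun j => by
      refine SigmaFinite.of_map (f := Prod.snd) _ measurable_snd.aemeasurable ?_
      rw [Measure.map_map measurable_snd (hm j)]
      exact (Measure.map_id (μ := (volume : Measure ℝ))).symm ▸ inferInstance
  have h1 : Measure.pi (fun j => (volume : Measure ℝ).map fun t => (c.maskTrans s A j t, t)) =
      (s.obsBase A ⊗ₘ c.fibreKernel s A).map e.symm := by
    refine Measure.pi_eq fun B hB => ?_
    have he : e.symm ⁻¹' Set.univ.pi B = {x | ∀ j, (x.1 j, x.2 j) ∈ B j} := by
      ext x; simp [Set.mem_pi]; rfl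
    rw [e.symm.map_apply, Measure.compProd_apply (e.symm.measurable (.univ_pi hB))]
    simp_rw [← hc.lintegral_fibreAt A _ (hB _)]
    rw [Study.obsBase, ← lintegral_pi_prod]
    · refine lintegral_congr fun z => ?_
      rw [Copula.fibreKernel_apply, Copula.fibreVec_eq, ← Measure.pi_pi, he]
      congr 1
      ext t
      simp [Set.mem_pi]
    · intro j
      obtain ⟨ρ, w, ψ, hρ, hw, -, hψ, h⟩ := c.exists_fibreAt_eq s A j
      simp_rw [h _ _ (measurable_prodMk_left (hB j))]
      refine Measurable.lintegral_prod_right' (f := fun x : ℝ × ℝ =>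
        w x * (Prod.mk x.1 ⁻¹' B j).indicator 1 (ψ x)) (hw.mul ?_)
      exact (measurable_one.indicator (hB j)).comp (measurable_fst.prodMk hψ)
  have h2 : (s.obsBase A ⊗ₘ c.fibreKernel s A) =
      (volume : Measure (Fin p → ℝ)).map fun t => (mask A (c.transVec s t), t) := by
    have h3 := congrArg (Measure.map e) h1
    rw [Measure.map_map e.measurable e.symm.measurable, e.self_comp_symm, Measure.map_id] at h3
    have hm' : Measurable fun (t : Fin p → ℝ) j => (c.maskTrans s A j (t j), t j) :=
      measurable_pi_lambda _ fun j => (hm j).comp (measurable_pi_apply j)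
    rw [← h3, ← Measure.pi_map_pi fun j => (hm j).aemeasurable, Measure.map_map e.measurable hm']
    rfl
  have h4 := Measure.lintegral_compProd (μ := s.obsBase A) (κ := c.fibreKernel s A) hφ
  simp only [Copula.fibreKernel_apply] at h4
  rw [← h4, h2, lintegral_map hφ]
  exact ((measurable_mask A).comp (c.measurable_transVec s)).prodMk measurable_id

theorem Copula.Valid.fibreAt_ne_zero (hc : c.Valid s) {A : Finset (Fin p)} {j : Fin p} {x : ℝ}
    (hx : j ∈ A → ∀ K, s.kind j = .categorical K → ∃ k ≤ K, x = (k : ℕ)) :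
    c.fibreAt s A j x ≠ 0 := by
  unfold Copula.fibreAt
  split_ifs with hj
  · unfold Copula.fibre
    cases hk : s.kind j with
    | continuous =>
      have := hc.scale_pos j hk
      intro h
      have h0 := congrArg (fun μ => μ Set.univ) h
      simp at h0
      linarith
    | categorical K =>
      obtain ⟨k, hkK, rfl⟩ := hx hj K hk
      have hlt : ∀ a ∈ (Finset.Icc 1 k).image (c.cut j),
          ∀ b ∈ (Finset.Icc (k + 1) K).image (c.cut j), a < b := by
        simp only [Finset.mem_image, Finset.mem_Icc]
        rintro _ ⟨m, hm, rfl⟩ _ ⟨l, hl, rfl⟩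
        exact hc.cut_lt j K hk m l hm.1 (by omega) hl.2
      -- A point strictly between the first $k$ cut points and the remaining ones; either family may
      -- be empty, which covers the extreme categories. It makes the open set `U` inside the fibre
      -- non-empty.
      obtain ⟨t₀, h1, h2⟩ := Order.exists_between_finsets _ _ hlt
      set U : Set ℝ := (⋂ m ∈ Finset.Icc 1 k, Set.Ioi (c.cut j m)) ∩
        ⋂ l ∈ Finset.Icc (k + 1) K, Set.Iio (c.cut j l) with hU
      have hUo : IsOpen U := (isOpen_biInter_finset fun _ _ => isOpen_Ioi).inter
        (isOpen_biInter_finset fun _ _ => isOpen_Iio)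
      have hUn : U.Nonempty := ⟨t₀, by
        simp only [hU, Set.mem_inter_iff, Set.mem_iInter, Set.mem_Ioi, Set.mem_Iio]
        exact ⟨fun m hm => h1 _ (Finset.mem_image_of_mem _ hm),
          fun l hl => h2 _ (Finset.mem_image_of_mem _ hl)⟩⟩
      have hsub : U ⊆ {t | c.trans s j t = (k : ℝ)} := by
        intro t ht
        simp only [hU, Set.mem_inter_iff, Set.mem_iInter, Set.mem_Ioi, Set.mem_Iio,
          Finset.mem_Icc] at ht
        simp only [Copula.trans, hk, Set.mem_ofPred_eq, Nat.cast_inj]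
        rw [show (Finset.Icc 1 K).filter (fun m => c.cut j m < t) = Finset.Icc 1 k from ?_]
        · simp
        · ext m
          simp only [Finset.mem_filter, Finset.mem_Icc]
          refine ⟨fun ⟨hm, hlt⟩ => ⟨hm.1, ?_⟩, fun hm => ⟨⟨hm.1, hm.2.trans hkK⟩, ht.1 m hm⟩⟩
          by_contra h
          exact (ht.2 m ⟨by omega, hm.2⟩).not_gt hlt
      rw [Ne, Measure.restrict_eq_zero]
      exact ((hUo.measure_pos volume hUn).trans_le (measure_mono hsub)).ne'
  · exact NeZero.ne _

theorem Copula.Valid.fibreVec_ne_zero (hc : c.Valid s) {A : Finset (Fin p)} {z : Fin p → ℝ}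
    (hz : z ∈ s.support A) : c.fibreVec s A z ≠ 0 := by
  rw [Copula.fibreVec_eq, Ne, ← Measure.measure_univ_eq_zero, Measure.pi_univ,
    Finset.prod_eq_zero_iff]
  rintro ⟨j, -, hj⟩
  exact hc.fibreAt_ne_zero (hz j) (Measure.measure_univ_eq_zero.1 hj)

theorem Copula.integrable_exp_fibreAt {b : ℝ} (hb : 0 < b) (A : Finset (Fin p)) (j : Fin p)
    (x : ℝ) : Integrable (fun t => Real.exp (-b * t ^ 2)) (c.fibreAt s A j x) := by
  have hv := integrable_exp_neg_mul_sq hb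
  unfold Copula.fibreAt Copula.fibre
  split_ifs
  · cases s.kind j with
    | continuous => exact (integrable_dirac (by simp)).smul_measure ENNReal.ofReal_ne_top
    | categorical K => exact hv.restrict
  · exact hv

/-- The response probabilities contribute only boundedness; the decay along free coordinates and
unbounded intervals comes from the normal density. -/
theorem Copula.integrable_fibreVec {S : Matrix (Fin p) (Fin p) ℝ} (hS : S.PosDef)
    {f : (Fin p → ℝ) → ℝ} (hf : Measurable f) (h0 : ∀ t, 0 ≤ f t) (h1 : ∀ t, f t ≤ 1)
    (A : Finset (Fin p)) (z : Fin p → ℝ) :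
    Integrable (fun t => gaussDensity S t * f t) (c.fibreVec s A z) := by
  obtain ⟨K, b, hb, hK⟩ := exists_gaussDensity_le hS
  have hi : Integrable (fun t : Fin p → ℝ => K * ∏ j, Real.exp (-b * t j ^ 2))
      (c.fibreVec s A z) :=
    (Integrable.fintype_prod fun j => Copula.integrable_exp_fibreAt hb A j (z j)).const_mul K
  refine hi.mono' ((measurable_gaussDensity S).mul hf).aestronglyMeasurable (ae_of_all _ fun t => ?_)
  have hg := (gaussDensity_pos hS t).le
  rw [Real.norm_of_nonneg (mul_nonneg hg (h0 t))]
  exact (mul_le_of_le_one_right hg (h1 t)).trans (hK t)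

theorem Copula.integrable_fibreVec_prod {G : Matrix (Fin p ⊕ Fin p) (Fin p ⊕ Fin p) ℝ}
    (hG : G.PosDef) {f : (Fin p → ℝ) × (Fin p → ℝ) → ℝ} (hf : Measurable f) (h0 : ∀ t, 0 ≤ f t)
    (h1 : ∀ t, f t ≤ 1) (A : Finset (Fin p)) (z z' : Fin p → ℝ) :
    Integrable (fun u => gaussDensity G (Sum.elim u.1 u.2) * f u)
      ((c.fibreVec s A z).prod (c.fibreVec s A z')) := by
  obtain ⟨K, b, hb, hK⟩ := exists_gaussDensity_le hG
  have hi' : ∀ z, Integrable (fun t : Fin p → ℝ => ∏ j, Real.exp (-b * t j ^ 2))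
      (c.fibreVec s A z) := fun z =>
    Integrable.fintype_prod fun j => Copula.integrable_exp_fibreAt hb A j (z j)
  have hi : Integrable (fun u : (Fin p → ℝ) × (Fin p → ℝ) =>
      K * ((∏ j, Real.exp (-b * u.1 j ^ 2)) * ∏ j, Real.exp (-b * u.2 j ^ 2)))
      ((c.fibreVec s A z).prod (c.fibreVec s A z')) :=
    ((hi' z).mul_prod (hi' z')).const_mul K
  have hm : Measurable fun u : (Fin p → ℝ) × (Fin p → ℝ) => Sum.elim u.1 u.2 :=
    measurable_pi_lambda _ fun j => by cases j <;> simp only [Sum.elim_inl, Sum.elim_inr] <;> fun_prop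
  refine hi.mono' (((measurable_gaussDensity G).comp hm).mul hf).aestronglyMeasurable
    (ae_of_all _ fun u => ?_)
  have hg := (gaussDensity_pos hG (Sum.elim u.1 u.2)).le
  rw [Real.norm_of_nonneg (mul_nonneg hg (h0 u))]
  refine (mul_le_of_le_one_right hg (h1 u)).trans ((hK _).trans ?_)
  rw [Fintype.prod_sum_type]
  simp only [Sum.elim_inl, Sum.elim_inr, le_refl]

end Fibre

/-! ### Response probabilities -/

section Response

variable {N p J : ℕ} {s : Study N p J} {i : Fin N}

theorem Item.prob_pos (it : Item) (y : ℕ) (θ : ℝ) : 0 < it.prob y θ :=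
  div_pos (Real.exp_pos _) (Finset.sum_pos (fun _ _ => Real.exp_pos _) (by simp))

theorem Item.prob_le_one (it : Item) {y : ℕ} (hy : y ≤ it.K) (θ : ℝ) : it.prob y θ ≤ 1 := by
  refine div_le_one_of_le₀ ?_ (Finset.sum_nonneg fun _ _ => (Real.exp_pos _).le)
  exact Finset.single_le_sum
    (f := fun k => Real.exp (∑ r ∈ Finset.Icc 1 k, (it.a * θ + it.b r)))
    (fun _ _ => (Real.exp_pos _).le) (Finset.mem_range.2 (by omega))

theorem Item.measurable_prob (it : Item) (y : ℕ) : Measurable (it.prob y) := by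
  unfold Item.prob
  fun_prop

theorem Study.prod_prob_pos (y : s.Resp i) (θ : ℝ) : 0 < ∏ l, (s.item l.1).prob (y l) θ :=
  Finset.prod_pos fun _ _ => Item.prob_pos _ _ _

theorem Study.prod_prob_le_one (y : s.Resp i) (θ : ℝ) :
    ∏ l, (s.item l.1).prob (y l) θ ≤ 1 :=
  Finset.prod_le_one (fun _ _ => (Item.prob_pos _ _ _).le) fun l _ =>
    Item.prob_le_one _ (Nat.lt_succ_iff.1 (y l).2) _

theorem Study.measurable_prod_prob (y : s.Resp i) :
    Measurable fun θ => ∏ l, (s.item l.1).prob (y l) θ :=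
  Finset.measurable_prod _ fun _ _ => Item.measurable_prob _ _

theorem Study.integrable_prod_prob (y : s.Resp i) (m : ℝ) (v : ℝ≥0) :
    Integrable (fun θ => ∏ l, (s.item l.1).prob (y l) θ) (gaussianReal m v) :=
  (integrable_const (1 : ℝ)).mono' (s.measurable_prod_prob y).aestronglyMeasurable
    (ae_of_all _ fun θ => by
      rw [Real.norm_of_nonneg (s.prod_prob_pos y θ).le]
      exact s.prod_prob_le_one y θ)

theorem Study.respProb_pos (y : s.Resp i) (m : ℝ) (v : ℝ≥0) : 0 < s.respProb y m v := by
  refine (integral_pos_iff_support_of_nonneg (fun θ => (s.prod_prob_pos y θ).le)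
    (s.integrable_prod_prob y m v)).2 ?_
  rw [show Function.support (fun θ => ∏ l, (s.item l.1).prob (y l) θ) = Set.univ from
    Set.eq_univ_of_forall fun θ => (s.prod_prob_pos y θ).ne']
  simp

theorem Study.respProb_le_one (y : s.Resp i) (m : ℝ) (v : ℝ≥0) : s.respProb y m v ≤ 1 := by
  have := integral_mono (s.integrable_prod_prob y m v) (integrable_const (1 : ℝ))
    fun θ => s.prod_prob_le_one y θ
  rw [integral_const, probReal_univ, one_smul] at this
  exact this

theorem Study.measurable_respProb (y : s.Resp i) (v : ℝ≥0) :
    Measurable fun m => s.respProb y m v := by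
  have h : ∀ m, s.respProb y m v =
      (∫⁻ θ, ENNReal.ofReal (∏ l, (s.item l.1).prob (y l) θ) ∂(gaussianReal m v)).toReal :=
    fun m => integral_eq_lintegral_of_nonneg_ae (ae_of_all _ fun θ => (s.prod_prob_pos y θ).le)
      (s.measurable_prod_prob y).aestronglyMeasurable
  simp_rw [h]
  have hg : Measurable fun m : ℝ => gaussianReal m v :=
    measurable_gaussianReal.comp (measurable_id.prodMk measurable_const)
  exact ((Measure.measurable_lintegral (s.measurable_prod_prob y).ennreal_ofReal).comp hg).ennreal_toReal

theorem PredictorKind.measurable_feature (k : PredictorKind) (l : ℕ) :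
    Measurable (k.feature l) := by
  cases k with
  | continuous => exact measurable_id
  | categorical K => exact Measurable.ite measurableSet_Ici measurable_const measurable_const

theorem Study.measurable_linPred (s : Study N p J) (β : s.Slopes) : Measurable (s.linPred β) :=
  Finset.measurable_sum _ fun j _ => Finset.measurable_sum _ fun _ _ =>
    ((PredictorKind.measurable_feature _ _).comp (measurable_pi_apply j)).const_mul _

theorem Model.resp_pos (P : Model s) (y : s.Resp i) (z : Fin p → ℝ) : 0 < P.resp y z :=
  s.respProb_pos _ _ _

theorem Model.resp_le_one (P : Model s) (y : s.Resp i) (z : Fin p → ℝ) : P.resp y z ≤ 1 :=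
  s.respProb_le_one _ _ _

theorem Model.measurable_resp (P : Model s) (y : s.Resp i) :
    Measurable fun t => P.resp y (P.cop.transVec s t) :=
  (s.measurable_respProb y P.resVar).comp
    (((s.measurable_linPred P.slope).comp (P.cop.measurable_transVec s)).const_add _)

end Response

/-! ### Densities of observed predictors and knockoffs -/

section Density

variable {N p J : ℕ} {s : Study N p J} {i : Fin N}

theorem Model.obsDensity_nonneg {P : Model s} (hP : P.Valid) (A : Finset (Fin p))
    (z : Fin p → ℝ) (y : s.Resp i) : 0 ≤ P.obsDensity A z y :=
  integral_nonneg fun t => mul_nonneg (gaussDensity_pos hP.cop.posDef t).le (P.resp_pos y _).le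

theorem Model.integrable_obsDensity {P : Model s} (hP : P.Valid) (A : Finset (Fin p))
    (z : Fin p → ℝ) (y : s.Resp i) :
    Integrable (fun t => gaussDensity P.cop.corr t * P.resp y (P.cop.transVec s t))
      (P.cop.fibreVec s A z) :=
  Copula.integrable_fibreVec hP.cop.posDef (P.measurable_resp y) (fun _ => (P.resp_pos y _).le)
    (fun _ => P.resp_le_one y _) A z

theorem Model.ofReal_obsDensity {P : Model s} (hP : P.Valid) (A : Finset (Fin p))
    (z : Fin p → ℝ) (y : s.Resp i) :
    ENNReal.ofReal (P.obsDensity A z y) =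
      ∫⁻ t, ENNReal.ofReal (gaussDensity P.cop.corr t * P.resp y (P.cop.transVec s t))
        ∂(P.cop.fibreVec s A z) :=
  ofReal_integral_eq_lintegral_ofReal (P.integrable_obsDensity hP A z y) (ae_of_all _ fun t =>
    mul_nonneg (gaussDensity_pos hP.cop.posDef t).le (P.resp_pos y _).le)

theorem Model.measurable_obsDensity {P : Model s} (hP : P.Valid) (A : Finset (Fin p))
    (y : s.Resp i) : Measurable fun z => P.obsDensity A z y := by
  have h : ∀ z, P.obsDensity A z y = (∫⁻ t, ENNReal.ofReal (gaussDensity P.cop.corr t *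
      P.resp y (P.cop.transVec s t)) ∂(P.cop.fibreVec s A z)).toReal := fun z => by
    rw [← ofReal_obsDensity hP, ENNReal.toReal_ofReal (obsDensity_nonneg hP A z y)]
  simp_rw [h]
  exact ((Measure.measurable_lintegral ((measurable_gaussDensity _).mul
    (P.measurable_resp y)).ennreal_ofReal).comp (P.cop.measurable_fibreVec s A)).ennreal_toReal

theorem Model.obsDensity_pos {P : Model s} (hP : P.Valid) {A : Finset (Fin p)}
    {z : Fin p → ℝ} (hz : z ∈ s.support A) (y : s.Resp i) : 0 < P.obsDensity A z y := by
  have h0 : ∀ t, 0 < gaussDensity P.cop.corr t * P.resp y (P.cop.transVec s t) := fun t =>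
    mul_pos (gaussDensity_pos hP.cop.posDef t) (P.resp_pos y _)
  refine (integral_pos_iff_support_of_nonneg (fun t => (h0 t).le)
    (P.integrable_obsDensity hP A z y)).2 ?_
  rw [Set.eq_univ_of_forall (s := Function.support _) fun t => (h0 t).ne']
  exact Measure.measure_univ_pos.2 (hP.cop.fibreVec_ne_zero hz)

theorem measurable_sumElim : Measurable fun u : (Fin p → ℝ) × (Fin p → ℝ) => Sum.elim u.1 u.2 :=
  measurable_pi_lambda _ fun j => by
    cases j <;> simp only [Sum.elim_inl, Sum.elim_inr] <;> fun_prop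

/-! ### Joint density of predictors and knockoffs under the plug-in model -/

variable {Q : Model s} {S : Fin p → ℝ}

/-- The integrand of `Copula.extDensity` when the slopes of the knockoffs are zero. -/
def Model.pairIntegrand (Q : Model s) (S : Fin p → ℝ) (y : s.Resp i)
    (u : (Fin p → ℝ) × (Fin p → ℝ)) : ℝ :=
  gaussDensity (Q.cop.knockoffCov S) (Sum.elim u.1 u.2) * Q.resp y (Q.cop.transVec s u.1)

/-- The joint density of observed predictors, knockoffs and responses. -/
def Model.jointDensity (Q : Model s) (S : Fin p → ℝ) (A : Finset (Fin p)) (z z' : Fin p → ℝ)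
    (y : s.Resp i) : ℝ :=
  ∫ u, Q.pairIntegrand S y u ∂((Q.cop.fibreVec s A z).prod (Q.cop.fibreVec s A z'))

theorem Model.extDensity_eq (A : Finset (Fin p)) (z z' : Fin p → ℝ) (y : s.Resp i) :
    Q.cop.extDensity s S ⟨Q.intercept, Q.slope, 0, Q.resVar⟩ A z z' y =
      Q.jointDensity S A z z' y := by
  simp only [Copula.extDensity, Model.jointDensity, Model.pairIntegrand, Model.resp,
    Study.linPred, Pi.zero_apply, zero_mul, Finset.sum_const_zero, add_zero]

theorem Model.measurable_pairIntegrand (y : s.Resp i) : Measurable (Q.pairIntegrand S y) :=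
  ((measurable_gaussDensity _).comp measurable_sumElim).mul
    ((Q.measurable_resp y).comp measurable_fst)

theorem Model.pairIntegrand_pos (hS : (Q.cop.knockoffCov S).PosDef) (y : s.Resp i)
    (u : (Fin p → ℝ) × (Fin p → ℝ)) : 0 < Q.pairIntegrand S y u :=
  mul_pos (gaussDensity_pos hS _) (Q.resp_pos y _)

theorem Model.integrable_pairIntegrand (hS : (Q.cop.knockoffCov S).PosDef) (A : Finset (Fin p))
    (z z' : Fin p → ℝ) (y : s.Resp i) :
    Integrable (Q.pairIntegrand S y) ((Q.cop.fibreVec s A z).prod (Q.cop.fibreVec s A z')) :=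
  Copula.integrable_fibreVec_prod hS ((Q.measurable_resp y).comp measurable_fst)
    (fun _ => (Q.resp_pos y _).le) (fun _ => Q.resp_le_one y _) A z z'

theorem Model.ofReal_jointDensity (hS : (Q.cop.knockoffCov S).PosDef) (A : Finset (Fin p))
    (z z' : Fin p → ℝ) (y : s.Resp i) :
    ENNReal.ofReal (Q.jointDensity S A z z' y) =
      ∫⁻ t, ∫⁻ t', ENNReal.ofReal (Q.pairIntegrand S y (t, t')) ∂(Q.cop.fibreVec s A z')
        ∂(Q.cop.fibreVec s A z) := by
  rw [Model.jointDensity, ofReal_integral_eq_lintegral_ofReal (integrable_pairIntegrand hS A z z' y)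
    (ae_of_all _ fun u => (pairIntegrand_pos hS y u).le),
    lintegral_prod _ (measurable_pairIntegrand y).ennreal_ofReal.aemeasurable]

theorem Model.measurable_jointDensity (hS : (Q.cop.knockoffCov S).PosDef) (A : Finset (Fin p))
    (y : s.Resp i) :
    Measurable fun u : (Fin p → ℝ) × (Fin p → ℝ) => Q.jointDensity S A u.1 u.2 y := by
  have h : ∀ u : (Fin p → ℝ) × (Fin p → ℝ), Q.jointDensity S A u.1 u.2 y =
      (∫⁻ t, ENNReal.ofReal (Q.pairIntegrand S y t)
        ∂((Q.cop.fibreKernel s A ∥ₖ Q.cop.fibreKernel s A) u)).toReal := fun u => by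
    rw [Kernel.parallelComp_apply]
    exact integral_eq_lintegral_of_nonneg_ae (ae_of_all _ fun u => (pairIntegrand_pos hS y u).le)
      (measurable_pairIntegrand y).aestronglyMeasurable
  simp_rw [h]
  exact ((Measure.measurable_lintegral (measurable_pairIntegrand y).ennreal_ofReal).comp
    (Kernel.measurable _)).ennreal_toReal

theorem Model.jointDensity_pos (hQ : Q.Valid) (hS : (Q.cop.knockoffCov S).PosDef)
    {A : Finset (Fin p)} {z z' : Fin p → ℝ} (hz : z ∈ s.support A) (hz' : z' ∈ s.support A)
    (y : s.Resp i) : 0 < Q.jointDensity S A z z' y := by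
  refine (integral_pos_iff_support_of_nonneg (fun u => (pairIntegrand_pos hS y u).le)
    (integrable_pairIntegrand hS A z z' y)).2 ?_
  rw [Set.eq_univ_of_forall (s := Function.support _) fun u => (pairIntegrand_pos hS y u).ne',
    Measure.measure_univ_pos, Ne, ← Measure.measure_univ_eq_zero, ← Set.univ_prod_univ,
    Measure.prod_prod, mul_eq_zero, Measure.measure_univ_eq_zero, Measure.measure_univ_eq_zero]
  exact not_or.2 ⟨hQ.cop.fibreVec_ne_zero hz, hQ.cop.fibreVec_ne_zero hz'⟩

theorem Model.knockoffDensity_eq (A : Finset (Fin p)) (z' z : Fin p → ℝ) (y : s.Resp i) :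
    Q.knockoffDensity S A z' z y = Q.jointDensity S A z z' y / Q.obsDensity A z y := by
  rw [Model.knockoffDensity, Model.extDensity_eq]

theorem Model.measurable_knockoffDensity (hQ : Q.Valid) (hS : (Q.cop.knockoffCov S).PosDef)
    (A : Finset (Fin p)) (y : s.Resp i) :
    Measurable fun u : (Fin p → ℝ) × (Fin p → ℝ) => Q.knockoffDensity S A u.2 u.1 y := by
  simp_rw [knockoffDensity_eq]
  exact (measurable_jointDensity hS A y).div ((measurable_obsDensity hQ A y).comp measurable_fst)

theorem Model.knockoffDensity_pos (hQ : Q.Valid) (hS : (Q.cop.knockoffCov S).PosDef)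
    {A : Finset (Fin p)} {z z' : Fin p → ℝ} (hz : z ∈ s.support A) (hz' : z' ∈ s.support A)
    (y : s.Resp i) : 0 < Q.knockoffDensity S A z' z y := by
  rw [knockoffDensity_eq]
  exact div_pos (jointDensity_pos hQ hS hz hz' y) (obsDensity_pos hQ hz y)

end Density

/-! ### The law of observed data and knockoffs of one student -/

section StudentLaw

variable {N p J : ℕ} {s : Study N p J} {i : Fin N}

theorem Study.measurable_obs {β : Type*} [MeasurableSpace β] {f : s.Obs i → β}
    (hf : ∀ A y, Measurable fun z => f (A, z, y)) : Measurable f :=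
  measurable_from_prod_countable_right fun A => measurable_from_prod_countable_left fun y => hf A y

theorem Study.measurable_pairObs {β : Type*} [MeasurableSpace β] {f : s.PairObs i → β}
    (hf : ∀ A y, Measurable fun u : (Fin p → ℝ) × (Fin p → ℝ) => f ((A, u.1, y), u.2)) :
    Measurable f := by
  let e : s.PairObs i → (Finset (Fin p) × s.Resp i) × ((Fin p → ℝ) × (Fin p → ℝ)) :=
    fun d => ((d.1.1, d.1.2.2), (d.1.2.1, d.2))
  have he : Measurable e := by fun_prop
  have h : Measurable fun x : (Finset (Fin p) × s.Resp i) × ((Fin p → ℝ) × (Fin p → ℝ)) =>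
      f ((x.1.1, x.2.1, x.1.2), x.2.2) :=
    measurable_from_prod_countable_right fun x => hf x.1 x.2
  exact h.comp he

theorem mask_transVec_mem_support (c : Copula p) (A : Finset (Fin p)) (t : Fin p → ℝ) :
    mask A (c.transVec s t) ∈ s.support A := by
  intro j hj K hK
  simp only [mask, hj, if_true, Copula.transVec, Copula.trans, hK]
  exact ⟨_, (Finset.card_filter_le _ _).trans (by simp), rfl⟩

variable {P Q : Model s} {S : Fin p → ℝ} {q : Fin N → Finset (Fin p) → (Fin p → ℝ) → ℝ}

/-- Only observed entries matter, so the missingness probability is a function of the recorded data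
and can be taken out of the integral over a fibre. -/
theorem SMAR.mask_eq {T : Finset (Fin p)} (h : SMAR q T) (i : Fin N) (A : Finset (Fin p))
    (z : Fin p → ℝ) : q i A (mask A z) = q i A z :=
  h i A _ _ fun j hj => by simp [mask, Finset.mem_of_mem_inter_left hj]

theorem Model.lintegral_obsLaw (hP : P.Valid) (hq : IsMissingness q) {T : Finset (Fin p)}
    (hT : SMAR q T) {φ : s.Obs i → ℝ≥0∞} (hφ : Measurable φ) :
    ∫⁻ x, φ x ∂(P.obsLaw q i) = ∑ A, ∑ y, ∫⁻ z,
      ENNReal.ofReal (P.obsDensity A z y * q i A z) * φ (A, z, y) ∂(s.obsBase A) := by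
  have hF := P.cop.measurable_transVec s
  have hg := measurable_gaussDensity P.cop.corr
  have hqm : ∀ A, Measurable fun t => q i A (P.cop.transVec s t) := fun A =>
    (hq.measurable i A).comp hF
  let w : (Fin p → ℝ) × s.Resp i × Finset (Fin p) → ℝ := fun x =>
    gaussDensity P.cop.corr x.1 * P.resp x.2.1 (P.cop.transVec s x.1) *
      q i x.2.2 (P.cop.transVec s x.1)
  have hw : Measurable w := measurable_from_prod_countable_left fun x =>
    (hg.mul (P.measurable_resp x.1)).mul (hqm x.2)
  let m : (Fin p → ℝ) × s.Resp i × Finset (Fin p) → s.Obs i := fun x =>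
    (x.2.2, mask x.2.2 (P.cop.transVec s x.1), x.2.1)
  have hm : Measurable m := measurable_from_prod_countable_left fun x =>
    (measurable_const (a := x.2)).prodMk
      (((measurable_mask x.2).comp hF).prodMk (measurable_const (a := x.1)))
  have hwφ : Measurable fun x => ENNReal.ofReal (w x) * φ (m x) :=
    hw.ennreal_ofReal.mul (hφ.comp hm)
  have hφm : Measurable fun x => φ (m x) := hφ.comp hm
  rw [Model.obsLaw, lintegral_map hφ hm]
  refine (lintegral_withDensity_eq_lintegral_mul _ hw.ennreal_ofReal hφm).trans ?_
  simp only [Pi.mul_apply]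
  rw [lintegral_prod_symm _ hwφ.aemeasurable, lintegral_prod_symm _
    (Measurable.lintegral_prod_left' hwφ).aemeasurable, lintegral_count, tsum_fintype]
  refine Finset.sum_congr rfl fun A _ => ?_
  rw [lintegral_count, tsum_fintype]
  refine Finset.sum_congr rfl fun y _ => ?_
  have hgr : Measurable fun t => ENNReal.ofReal
      (gaussDensity P.cop.corr t * P.resp y (P.cop.transVec s t)) :=
    (hg.mul (P.measurable_resp y)).ennreal_ofReal
  have hφz : Measurable fun z => φ (A, z, y) := hφ.comp (by fun_prop)
  have hqφ : Measurable fun z => ENNReal.ofReal (q i A z) * φ (A, z, y) :=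
    (hq.measurable i A).ennreal_ofReal.mul hφz
  have h := hP.cop.lintegral_fibreVec A (φ := fun x => ENNReal.ofReal
      (gaussDensity P.cop.corr x.2 * P.resp y (P.cop.transVec s x.2)) *
      (ENNReal.ofReal (q i A x.1) * φ (A, x.1, y)))
    ((hgr.comp measurable_snd).mul (hqφ.comp measurable_fst))
  refine Eq.trans (lintegral_congr fun t => ?_) (h.symm.trans (lintegral_congr fun z => ?_))
  · rw [hT.mask_eq, ← mul_assoc, ← ENNReal.ofReal_mul (mul_nonneg
      (gaussDensity_pos hP.cop.posDef t).le (P.resp_pos y _).le)]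
  · dsimp only
    rw [lintegral_mul_const _ hgr, ENNReal.ofReal_mul (obsDensity_nonneg hP A z y),
      ofReal_obsDensity hP, mul_assoc]

/-- The unnormalised posterior of the underlying variables. -/
def Model.postMeas (Q : Model s) (x : s.Obs i) : Measure (Fin p → ℝ) :=
  (Q.cop.fibreVec s x.1 x.2.1).withDensity fun t =>
    ENNReal.ofReal (gaussDensity Q.cop.corr t * Q.resp x.2.2 (Q.cop.transVec s t))

theorem Model.posterior_eq (Q : Model s) (x : s.Obs i) :
    Q.posterior x = (Q.postMeas x Set.univ)⁻¹ • Q.postMeas x := rfl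

theorem Model.postMeas_univ (hQ : Q.Valid) (x : s.Obs i) :
    Q.postMeas x Set.univ = ENNReal.ofReal (Q.obsDensity x.1 x.2.1 x.2.2) := by
  rw [Model.postMeas, withDensity_apply _ .univ, Measure.restrict_univ, ofReal_obsDensity hQ]

theorem Model.measurable_postMeas : Measurable fun x : s.Obs i => Q.postMeas x := by
  refine Study.measurable_obs fun A y => ?_
  have hgr : Measurable fun t => ENNReal.ofReal
      (gaussDensity Q.cop.corr t * Q.resp y (Q.cop.transVec s t)) :=
    ((measurable_gaussDensity _).mul (Q.measurable_resp y)).ennreal_ofReal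
  refine Measure.measurable_of_measurable_coe _ fun B hB => ?_
  simp_rw [Model.postMeas, withDensity_apply _ hB, ← lintegral_indicator hB]
  exact (Measure.measurable_lintegral (hgr.indicator hB)).comp (Q.cop.measurable_fibreVec s A)

theorem Model.measurable_posterior : Measurable fun x : s.Obs i => Q.posterior x := by
  refine Measure.measurable_of_measurable_coe _ fun B hB => ?_
  simp_rw [posterior_eq, Measure.smul_apply, smul_eq_mul]
  exact ((Measure.measurable_coe .univ).comp measurable_postMeas).inv.mul
    ((Measure.measurable_coe hB).comp measurable_postMeas)

/-- Holds also where normalisation fails: a total mass of $0$ or $\infty$ yields the zero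
contribution to the total mass. The knockoff law is therefore finite for all data, including data
outside the support. -/
theorem Model.posterior_univ_le (x : s.Obs i) : Q.posterior x Set.univ ≤ 1 := by
  rw [posterior_eq, Measure.smul_apply, smul_eq_mul]
  exact ENNReal.inv_mul_le_one _

theorem Model.posterior_univ (hQ : Q.Valid) {x : s.Obs i} (hx : x.2.1 ∈ s.support x.1) :
    Q.posterior x Set.univ = 1 := by
  rw [posterior_eq, Measure.smul_apply, smul_eq_mul, postMeas_univ hQ]
  exact ENNReal.inv_mul_cancel (by simpa using obsDensity_pos hQ hx _) ENNReal.ofReal_ne_top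

theorem Copula.measurable_knockoffStep (c : Copula p) (S : Fin p → ℝ) :
    Measurable (c.knockoffStep S) := by
  have h : Measurable fun u : (Fin p → ℝ) × (Fin p → ℝ) => ENNReal.ofReal
      (gaussDensity (c.knockoffCov S) (Sum.elim u.1 u.2) / gaussDensity c.corr u.1) :=
    (((measurable_gaussDensity _).comp measurable_sumElim).div
      ((measurable_gaussDensity _).comp measurable_fst)).ennreal_ofReal
  refine Measure.measurable_of_measurable_coe _ fun B hB => ?_
  simp_rw [Copula.knockoffStep, withDensity_apply _ hB]
  exact Measurable.lintegral_prod_right' h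

theorem Copula.Valid.knockoffStep_univ {c : Copula p} (hc : c.Valid s)
    (hS : (c.knockoffCov S).PosDef) (t : Fin p → ℝ) : c.knockoffStep S t Set.univ = 1 := by
  rw [Copula.knockoffStep, withDensity_apply _ .univ, Measure.restrict_univ]
  have hB : (c.corr - Matrix.diagonal S).transpose = c.corr - Matrix.diagonal S := by
    rw [Matrix.transpose_sub, Matrix.diagonal_transpose]
    congr 1
    simpa using hc.posDef.isHermitian.eq
  have h := lintegral_gaussDensity_fromBlocks (A := c.corr) (B := c.corr - Matrix.diagonal S)
    (D := c.corr) (by rw [hB]; exact hS) hc.posDef t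
  rw [hB] at h
  exact h

theorem Model.measurable_knockoffLaw : Measurable fun x : s.Obs i => Q.knockoffLaw S x := by
  have h : Measurable fun x : s.Obs i => (Q.posterior x).bind (Q.cop.knockoffStep S) :=
    (Measure.measurable_bind' (Q.cop.measurable_knockoffStep S)).comp measurable_posterior
  refine Study.measurable_obs fun A y => ?_
  exact (Measure.measurable_map _ ((measurable_mask A).comp (Q.cop.measurable_transVec s))).comp
    (h.comp (by fun_prop))

theorem Model.knockoffLaw_univ_eq (hQ : Q.Valid) (hS : (Q.cop.knockoffCov S).PosDef)
    (x : s.Obs i) : Q.knockoffLaw S x Set.univ = Q.posterior x Set.univ := by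
  have hm : Measurable fun t => mask x.1 (Q.cop.transVec s t) :=
    (measurable_mask x.1).comp (Q.cop.measurable_transVec s)
  rw [Model.knockoffLaw, Measure.map_apply hm .univ, Set.preimage_univ,
    Measure.bind_apply .univ (Q.cop.measurable_knockoffStep S).aemeasurable]
  simp_rw [hQ.cop.knockoffStep_univ hS]
  simp

theorem Model.isFiniteMeasure_knockoffLaw (hQ : Q.Valid) (hS : (Q.cop.knockoffCov S).PosDef)
    (x : s.Obs i) : IsFiniteMeasure (Q.knockoffLaw S x) :=
  ⟨by rw [knockoffLaw_univ_eq hQ hS]; exact (posterior_univ_le x).trans_lt ENNReal.one_lt_top⟩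

theorem Model.isProbabilityMeasure_knockoffLaw (hQ : Q.Valid)
    (hS : (Q.cop.knockoffCov S).PosDef) {x : s.Obs i} (hx : x.2.1 ∈ s.support x.1) :
    IsProbabilityMeasure (Q.knockoffLaw S x) :=
  ⟨by rw [knockoffLaw_univ_eq hQ hS, posterior_univ hQ hx]⟩

/-- The posterior weight times the conditional density of the knockoff step is the joint integrand
over the normalising constant. Disintegrating $t'$ along its recorded value and exchanging integrals
turns this into a density on recorded knockoffs. -/
theorem Model.lintegral_knockoffLaw (hQ : Q.Valid) (hS : (Q.cop.knockoffCov S).PosDef)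
    {x : s.Obs i} (hx : x.2.1 ∈ s.support x.1) {φ : (Fin p → ℝ) → ℝ≥0∞} (hφ : Measurable φ) :
    ∫⁻ z', φ z' ∂(Q.knockoffLaw S x) =
      ∫⁻ z', ENNReal.ofReal (Q.knockoffDensity S x.1 z' x.2.1 x.2.2) * φ z' ∂(s.obsBase x.1) := by
  obtain ⟨A, z, y⟩ := x
  have hF := Q.cop.measurable_transVec s
  have hmF : Measurable fun t => mask A (Q.cop.transVec s t) := (measurable_mask A).comp hF
  have hφF : Measurable fun t => φ (mask A (Q.cop.transVec s t)) := hφ.comp hmF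
  have hstep := Q.cop.measurable_knockoffStep S
  have hgr : Measurable fun t => ENNReal.ofReal
      (gaussDensity Q.cop.corr t * Q.resp y (Q.cop.transVec s t)) :=
    ((measurable_gaussDensity _).mul (Q.measurable_resp y)).ennreal_ofReal
  have hD : ENNReal.ofReal (Q.obsDensity A z y) ≠ 0 := by
    simpa using obsDensity_pos hQ hx y
  have hI : Measurable fun u => ENNReal.ofReal (Q.pairIntegrand S y u) :=
    (measurable_pairIntegrand y).ennreal_ofReal
  have h1 : ∫⁻ z', φ z' ∂(Q.knockoffLaw S (A, z, y)) = (ENNReal.ofReal (Q.obsDensity A z y))⁻¹ *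
      ∫⁻ t, (∫⁻ t', ENNReal.ofReal (Q.pairIntegrand S y (t, t')) *
        φ (mask A (Q.cop.transVec s t'))) ∂(Q.cop.fibreVec s A z) := by
    have hlm : Measurable fun t => ∫⁻ t', φ (mask A (Q.cop.transVec s t'))
        ∂(Q.cop.knockoffStep S t) := (Measure.measurable_lintegral hφF).comp hstep
    rw [Model.knockoffLaw, lintegral_map hφ hmF,
      Measure.lintegral_bind hstep.aemeasurable hφF.aemeasurable, posterior_eq,
      lintegral_smul_measure, postMeas_univ hQ, Model.postMeas,
      lintegral_withDensity_eq_lintegral_mul _ hgr hlm, smul_eq_mul]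
    congr 1
    refine lintegral_congr fun t => ?_
    have hd : Measurable fun t' => ENNReal.ofReal
        (gaussDensity (Q.cop.knockoffCov S) (Sum.elim t t') / gaussDensity Q.cop.corr t) :=
      (((measurable_gaussDensity _).comp (measurable_sumElim.comp measurable_prodMk_left)).div_const
        _).ennreal_ofReal
    rw [Pi.mul_apply, Copula.knockoffStep, lintegral_withDensity_eq_lintegral_mul _ hd hφF,
      ← lintegral_const_mul _ (hd.mul hφF)]
    -- The density of $t$ cancels against the denominator of the conditional density of $t'$.
    refine lintegral_congr fun t' => ?_
    have hg := gaussDensity_pos hQ.cop.posDef t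
    rw [Pi.mul_apply, ← mul_assoc, ← ENNReal.ofReal_mul (mul_nonneg hg.le (Q.resp_pos y _).le)]
    congr 2
    simp only [Model.pairIntegrand]
    field_simp
  have h2 : ∀ t, ∫⁻ t', ENNReal.ofReal (Q.pairIntegrand S y (t, t')) *
        φ (mask A (Q.cop.transVec s t')) =
      ∫⁻ z', ∫⁻ t', ENNReal.ofReal (Q.pairIntegrand S y (t, t')) * φ z' ∂(Q.cop.fibreVec s A z')
        ∂(s.obsBase A) := fun t =>
    (hQ.cop.lintegral_fibreVec A (φ := fun v => ENNReal.ofReal (Q.pairIntegrand S y (t, v.2)) *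
      φ v.1) ((hI.comp (measurable_const.prodMk measurable_snd)).mul
        (hφ.comp measurable_fst))).symm
  rw [h1]
  simp_rw [h2]
  have hK : Measurable fun x : (Fin p → ℝ) × (Fin p → ℝ) =>
      ∫⁻ t', ENNReal.ofReal (Q.pairIntegrand S y (x.1, t')) * φ x.2
        ∂(Q.cop.fibreKernel s A x.2) := by
    have := Measurable.lintegral_kernel_prod_right' (κ := (Q.cop.fibreKernel s A).comap
      (Prod.snd : (Fin p → ℝ) × (Fin p → ℝ) → Fin p → ℝ) measurable_snd)
      (f := fun v => ENNReal.ofReal (Q.pairIntegrand S y (v.1.1, v.2)) * φ v.1.2)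
      ((hI.comp (by fun_prop)).mul (hφ.comp (by fun_prop)))
    exact this
  rw [lintegral_lintegral_swap (f := fun t z' => ∫⁻ t',
      ENNReal.ofReal (Q.pairIntegrand S y (t, t')) * φ z' ∂(Q.cop.fibreVec s A z'))
    hK.aemeasurable]
  have hJ : ∀ z', ENNReal.ofReal (Q.jointDensity S A z z' y) * φ z' =
      ∫⁻ t, ∫⁻ t', ENNReal.ofReal (Q.pairIntegrand S y (t, t')) * φ z' ∂(Q.cop.fibreVec s A z')
        ∂(Q.cop.fibreVec s A z) := fun z' => by
    rw [ofReal_jointDensity hS, ← lintegral_mul_const]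
    · refine lintegral_congr fun t => ?_
      rw [← lintegral_mul_const]
      exact hI.comp measurable_prodMk_left
    · exact Measurable.lintegral_prod_right' hI
  simp_rw [← hJ]
  have hJm : Measurable fun z' => ENNReal.ofReal (Q.jointDensity S A z z' y) * φ z' :=
    ((measurable_jointDensity hS A y).comp measurable_prodMk_left).ennreal_ofReal.mul hφ
  rw [← lintegral_const_mul _ hJm]
  refine lintegral_congr fun z' => ?_
  rw [knockoffDensity_eq, ENNReal.ofReal_div_of_pos (obsDensity_pos hQ hx y), ← mul_assoc,
    div_eq_mul_inv, mul_comm (ENNReal.ofReal (Q.obsDensity A z y))⁻¹]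

end StudentLaw

/-! ### The law of the data of one run -/

section RunLaw

variable {N p J : ℕ} {s : Study N p J} {i : Fin N}

theorem measurable_map_prodMk {α β : Type*} [MeasurableSpace α] [MeasurableSpace β]
    {κ : α → Measure β} [∀ a, IsFiniteMeasure (κ a)] (hκ : Measurable κ) :
    Measurable fun a => (κ a).map (Prod.mk a) := by
  have h : ∀ a, IsFiniteMeasure ((κ a).map (Prod.mk a)) := fun a => inferInstance
  refine Measurable.measure_of_isPiSystem generateFrom_prod.symm isPiSystem_prod ?_ ?_
  · rintro _ ⟨B, hB, C, hC, rfl⟩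
    have h : ∀ a, (κ a).map (Prod.mk a) (B ×ˢ C) = B.indicator 1 a * κ a C := fun a => by
      rw [Measure.map_apply measurable_prodMk_left (hB.prod hC)]
      by_cases ha : a ∈ B <;> simp [ha]
    simp_rw [h]
    exact (measurable_one.indicator hB).mul (Measure.measurable_measure.1 hκ C hC)
  · simp_rw [Measure.map_apply measurable_prodMk_left MeasurableSet.univ, Set.preimage_univ]
    exact Measure.measurable_measure.1 hκ _ .univ

theorem Study.measurableSet_support (s : Study N p J) (A : Finset (Fin p)) :
    MeasurableSet (s.support A) := by
  have h : s.support A = ⋂ j ∈ A, (fun z : Fin p → ℝ => z j) ⁻¹'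
      {x | ∀ K, s.kind j = .categorical K → ∃ k : ℕ, k ≤ K ∧ x = k} := by
    ext z; simp [Study.support]
  rw [h]
  refine Finset.measurableSet_biInter _ fun j _ => measurable_pi_apply j ?_
  cases s.kind j with
  | continuous => simp
  | categorical K =>
    refine Set.Countable.measurableSet ((Set.countable_range (Nat.cast : ℕ → ℝ)).mono ?_)
    intro x hx
    obtain ⟨k, -, rfl⟩ := hx K rfl
    exact ⟨k, rfl⟩

variable {P Q : Model s} {S : Fin p → ℝ} {q : Fin N → Finset (Fin p) → (Fin p → ℝ) → ℝ}

theorem Copula.measurable_record (c : Copula p) : Measurable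
    fun x : (Fin p → ℝ) × s.Resp i × Finset (Fin p) =>
      ((x.2.2, mask x.2.2 (c.transVec s x.1), x.2.1) : s.Obs i) :=
  measurable_from_prod_countable_left fun x => (measurable_const (a := x.2)).prodMk
    (((measurable_mask x.2).comp (c.measurable_transVec s)).prodMk (measurable_const (a := x.1)))

theorem Model.ae_obsLaw_mem_support (P : Model s)
    (q : Fin N → Finset (Fin p) → (Fin p → ℝ) → ℝ) (i : Fin N) :
    ∀ᵐ x ∂(P.obsLaw q i), x.2.1 ∈ s.support x.1 := by
  have h : MeasurableSet {x : s.Obs i | x.2.1 ∈ s.support x.1} :=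
    measurableSet_setOfPred.2 (Study.measurable_obs fun A _ =>
      measurableSet_setOfPred.1 (s.measurableSet_support A))
  rw [Model.obsLaw, ae_map_iff (P.cop.measurable_record).aemeasurable h]
  exact ae_of_all _ fun x => mask_transVec_mem_support P.cop x.2.2 x.1

/-- A crude bound by the number of pairs of a response vector and an observed set is enough; the
total mass of the study law is later inherited from the underlying probability space. -/
theorem Model.isFiniteMeasure_obsLaw (hP : P.Valid) (hq : IsMissingness q) :
    IsFiniteMeasure (P.obsLaw q i) := by
  refine ⟨?_⟩
  rw [Model.obsLaw, Measure.map_apply P.cop.measurable_record .univ, Set.preimage_univ,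
    withDensity_apply _ .univ, Measure.restrict_univ]
  have hg : Measurable fun t => ENNReal.ofReal (gaussDensity P.cop.corr t) :=
    (measurable_gaussDensity _).ennreal_ofReal
  have h1 := lintegral_prod_mul (μ := (volume : Measure (Fin p → ℝ)))
    (ν := ((Measure.count : Measure (s.Resp i)).prod (Measure.count : Measure (Finset (Fin p)))))
    hg.aemeasurable (g := fun _ => 1) aemeasurable_const
  refine lt_of_le_of_lt (lintegral_mono fun x => ?_) (h1.trans_lt ?_)
  · rw [mul_one]
    refine ENNReal.ofReal_le_ofReal ?_
    have h0 := (gaussDensity_pos hP.cop.posDef x.1).le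
    have hq1 : q i x.2.2 (P.cop.transVec s x.1) ≤ 1 := by
      rw [← hq.sum_eq_one i (P.cop.transVec s x.1)]
      exact Finset.single_le_sum (f := fun A => q i A (P.cop.transVec s x.1))
        (fun A _ => hq.nonneg i A _) (Finset.mem_univ _)
    have hr := P.resp_pos x.2.1 (P.cop.transVec s x.1)
    exact (mul_le_of_le_one_right (mul_nonneg h0 hr.le) hq1).trans
      (mul_le_of_le_one_right h0 (P.resp_le_one _ _))
  · rw [lintegral_gaussDensity hP.cop.posDef, one_mul]
    simp only [lintegral_one]
    exact measure_lt_top _ _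

/-- The law of the observed data of student `i` and the knockoffs of a single run. -/
def pairLaw (P Q : Model s) (S : Fin p → ℝ) (q : Fin N → Finset (Fin p) → (Fin p → ℝ) → ℝ)
    (i : Fin N) : Measure (s.PairObs i) :=
  (P.obsLaw q i).bind fun x => (Q.knockoffLaw S x).map (Prod.mk x)

theorem measurable_knockoffLaw_map (hQ : Q.Valid) (hS : (Q.cop.knockoffCov S).PosDef) :
    Measurable fun x : s.Obs i => (Q.knockoffLaw S x).map (Prod.mk x) := by
  have := Model.isFiniteMeasure_knockoffLaw (i := i) hQ hS
  exact measurable_map_prodMk Model.measurable_knockoffLaw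

theorem measurable_pi_knockoffLaw_map (hQ : Q.Valid) (hS : (Q.cop.knockoffCov S).PosDef) (M : ℕ) :
    Measurable fun x : s.Obs i =>
      (Measure.pi fun _ : Fin M => Q.knockoffLaw S x).map (Prod.mk x) := by
  have := Model.isFiniteMeasure_knockoffLaw (i := i) hQ hS
  exact measurable_map_prodMk (measurable_pi_measure fun _ => Model.measurable_knockoffLaw)

theorem isFiniteMeasure_pairLaw (hP : P.Valid) (hQ : Q.Valid)
    (hS : (Q.cop.knockoffCov S).PosDef) (hq : IsMissingness q) :
    IsFiniteMeasure (pairLaw P Q S q i) := by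
  have := Model.isFiniteMeasure_obsLaw (i := i) hP hq
  refine ⟨?_⟩
  rw [pairLaw, Measure.bind_apply .univ (measurable_knockoffLaw_map hQ hS).aemeasurable]
  refine lt_of_le_of_lt (lintegral_mono (g := fun _ => 1) fun x => ?_) (by simp)
  rw [Measure.map_apply measurable_prodMk_left .univ, Set.preimage_univ,
    Model.knockoffLaw_univ_eq hQ hS]
  exact Model.posterior_univ_le x

/-- The other runs integrate out because the knockoff law has mass one for almost all data. -/
theorem map_runs_eq_pairLaw (hQ : Q.Valid) (hS : (Q.cop.knockoffCov S).PosDef) {M : ℕ}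
    (m : Fin M) :
    ((P.obsLaw q i).bind fun x =>
      (Measure.pi fun _ : Fin M => Q.knockoffLaw S x).map (Prod.mk x)).map
        (fun x => (x.1, x.2 m)) = pairLaw P Q S q i := by
  have hm : Measurable fun x : s.Obs i × (Fin M → Fin p → ℝ) => (x.1, x.2 m) := by fun_prop
  ext B hB
  rw [Measure.map_apply hm hB, pairLaw,
    Measure.bind_apply (hm hB) (measurable_pi_knockoffLaw_map hQ hS M).aemeasurable,
    Measure.bind_apply hB (measurable_knockoffLaw_map hQ hS).aemeasurable]
  refine lintegral_congr_ae ?_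
  filter_upwards [P.ae_obsLaw_mem_support q i] with x hx
  have := Model.isProbabilityMeasure_knockoffLaw hQ hS hx
  rw [Measure.map_apply measurable_prodMk_left (hm hB), Measure.map_apply measurable_prodMk_left hB,
    ← (measurePreserving_eval (fun _ : Fin M => Q.knockoffLaw S x) m).measure_preimage
      (measurable_prodMk_left hB).nullMeasurableSet]
  rfl

theorem map_studyLaw (hP : P.Valid) (hQ : Q.Valid) (hS : (Q.cop.knockoffCov S).PosDef)
    (hq : IsMissingness q) {M : ℕ} (m : Fin M) :
    (studyLaw P Q S q M).map (fun d i => ((d i).1, (d i).2 m)) =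
      Measure.pi fun i => pairLaw P Q S q i := by
  have h : ∀ i : Fin N, SigmaFinite (((P.obsLaw q i).bind fun x =>
      (Measure.pi fun _ : Fin M => Q.knockoffLaw S x).map (Prod.mk x)).map
        (fun x => (x.1, x.2 m))) := fun i => by
    rw [map_runs_eq_pairLaw hQ hS m]
    have := isFiniteMeasure_pairLaw (i := i) hP hQ hS hq
    infer_instance
  rw [studyLaw, Measure.pi_map_pi (f := fun (i : Fin N) (x : s.Obs i × (Fin M → Fin p → ℝ)) =>
    ((x.1, x.2 m) : s.PairObs i)) fun i => Measurable.aemeasurable (by fun_prop)]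
  simp_rw [map_runs_eq_pairLaw hQ hS m]

/-- The density of `pairLaw`. -/
def pairDensity (P Q : Model s) (S : Fin p → ℝ) (q : Fin N → Finset (Fin p) → (Fin p → ℝ) → ℝ)
    (A : Finset (Fin p)) (y : s.Resp i) (u : (Fin p → ℝ) × (Fin p → ℝ)) : ℝ :=
  P.obsDensity A u.1 y * q i A u.1 * Q.knockoffDensity S A u.2 u.1 y

theorem measurable_pairDensity (hP : P.Valid) (hQ : Q.Valid) (hS : (Q.cop.knockoffCov S).PosDef)
    (hq : IsMissingness q) (A : Finset (Fin p)) (y : s.Resp i) :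
    Measurable (pairDensity P Q S q A y) :=
  (((Model.measurable_obsDensity hP A y).comp measurable_fst).mul
    ((hq.measurable i A).comp measurable_fst)).mul (Model.measurable_knockoffDensity hQ hS A y)

theorem lintegral_pairLaw (hP : P.Valid) (hQ : Q.Valid) (hS : (Q.cop.knockoffCov S).PosDef)
    (hq : IsMissingness q) {T : Finset (Fin p)} (hT : SMAR q T) {φ : s.PairObs i → ℝ≥0∞}
    (hφ : Measurable φ) :
    ∫⁻ d, φ d ∂(pairLaw P Q S q i) = ∑ A, ∑ y, ∫⁻ u,
      ENNReal.ofReal (pairDensity P Q S q A y u) * φ ((A, u.1, y), u.2)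
        ∂((s.obsBase A).prod (s.obsBase A)) := by
  have hκ := measurable_knockoffLaw_map (i := i) hQ hS
  have hκφ : Measurable fun x : s.Obs i => ∫⁻ d, φ d ∂((Q.knockoffLaw S x).map (Prod.mk x)) :=
    (Measure.measurable_lintegral hφ).comp hκ
  rw [pairLaw, Measure.lintegral_bind hκ.aemeasurable hφ.aemeasurable,
    Model.lintegral_obsLaw hP hq hT hκφ]
  refine Finset.sum_congr rfl fun A _ => Finset.sum_congr rfl fun y _ => ?_
  have hφA : Measurable fun u : (Fin p → ℝ) × (Fin p → ℝ) => φ ((A, u.1, y), u.2) :=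
    hφ.comp (by fun_prop)
  have hF : Measurable fun u =>
      ENNReal.ofReal (pairDensity P Q S q A y u) * φ ((A, u.1, y), u.2) :=
    (measurable_pairDensity hP hQ hS hq A y).ennreal_ofReal.mul hφA
  rw [lintegral_prod _ hF.aemeasurable]
  refine lintegral_congr_ae ?_
  -- The density of the knockoff law is available only for data in the support.
  filter_upwards [s.ae_mem_support A] with z hz
  have hφz : Measurable fun z' => φ ((A, z, y), z') := hφ.comp measurable_prodMk_left
  rw [lintegral_map hφ measurable_prodMk_left,
    Model.lintegral_knockoffLaw hQ hS (x := (A, z, y)) hz hφz, ← lintegral_const_mul]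
  · refine lintegral_congr fun z' => ?_
    rw [pairDensity, ENNReal.ofReal_mul (mul_nonneg (Model.obsDensity_nonneg hP A z y)
      (hq.nonneg i A z)), mul_assoc]
  · exact ((Model.measurable_knockoffDensity hQ hS A y).comp
      measurable_prodMk_left).ennreal_ofReal.mul hφz

end RunLaw

/-! ### Exchanging a null predictor with its knockoff -/

section Tilt

variable {N p J : ℕ} {s : Study N p J} {i : Fin N}

/-- Exchange the observed predictors in `T` of one student with their knockoffs. -/
def swapObs (T : Finset (Fin p)) (d : s.PairObs i) : s.PairObs i :=
  ((d.1.1, fun j => if j ∈ T ∧ j ∈ d.1.1 then d.2 j else d.1.2.1 j, d.1.2.2),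
    fun j => if j ∈ T ∧ j ∈ d.1.1 then d.1.2.1 j else d.2 j)

theorem swapObs_mk (T A : Finset (Fin p)) (y : s.Resp i) (u : (Fin p → ℝ) × (Fin p → ℝ)) :
    swapObs T (((A, u.1, y), u.2) : s.PairObs i) =
      ((A, (swapCoord (T ∩ A) u).1, y), (swapCoord (T ∩ A) u).2) := by
  simp [swapObs, swapCoord]

theorem measurable_swapObs (T : Finset (Fin p)) :
    Measurable (swapObs T : s.PairObs i → s.PairObs i) := by
  refine Study.measurable_pairObs fun A y => ?_
  simp_rw [swapObs_mk]
  have h := measurable_swapCoord (T ∩ A)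
  have h' : Measurable fun u : (Fin p → ℝ) × (Fin p → ℝ) =>
      (((A, u.1, y), u.2) : s.PairObs i) := by fun_prop
  exact h'.comp h

/-- The contribution of one student to the observed divergence. -/
def klTerm (P Q : Model s) (S : Fin p → ℝ) (j : Fin p) (d : s.PairObs i) : ℝ :=
  if j ∈ d.1.1 then
    Real.log
      ((P.condDensity d.1.1 j (d.1.2.1 j) d.1.2.1 d.1.2.2 *
          Q.knockoffDensity S d.1.1 d.2 d.1.2.1 d.1.2.2) /
        (P.condDensity d.1.1 j (d.2 j) d.1.2.1 d.1.2.2 *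
          Q.knockoffDensity S d.1.1 (Function.update d.2 j (d.1.2.1 j))
            (Function.update d.1.2.1 j (d.2 j)) d.1.2.2))
  else 0

theorem KLhat_eq_sum (P Q : Model s) (S : Fin p → ℝ) (j : Fin p)
    (d : (i : Fin N) → s.PairObs i) : KLhat P Q S j d = ∑ i, klTerm P Q S j (d i) := rfl

variable {P Q : Model s} {S : Fin p → ℝ} {q : Fin N → Finset (Fin p) → (Fin p → ℝ) → ℝ}

theorem measurable_klTerm (hP : P.Valid) (hQ : Q.Valid) (hS : (Q.cop.knockoffCov S).PosDef)
    (j : Fin p) : Measurable (klTerm P Q S j : s.PairObs i → ℝ) := by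
  refine Study.measurable_pairObs fun A y => ?_
  by_cases hj : j ∈ A
  · simp only [klTerm, hj, if_true, Model.condDensity]
    have h1 := Model.measurable_obsDensity (i := i) hP A y
    have h2 := Model.measurable_obsDensity (i := i) hP (A.erase j) y
    have h3 := Model.measurable_knockoffDensity (i := i) hQ hS A y
    have h4 : Measurable fun u : (Fin p → ℝ) × (Fin p → ℝ) => Function.update u.1 j (u.2 j) := by
      fun_prop
    have h5 : Measurable fun u : (Fin p → ℝ) × (Fin p → ℝ) => Function.update u.2 j (u.1 j) := by
      fun_prop
    have h6 : Measurable fun u : (Fin p → ℝ) × (Fin p → ℝ) => Function.update u.1 j (u.1 j) := by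
      fun_prop
    exact (((((h1.comp h6).div (h2.comp measurable_fst)).mul h3).div
      (((h1.comp h4).div (h2.comp measurable_fst)).mul (h3.comp (h4.prodMk h5))))).log
  · simp only [klTerm, hj, if_false]
    exact measurable_const

theorem measurable_KLhat (hP : P.Valid) (hQ : Q.Valid) (hS : (Q.cop.knockoffCov S).PosDef)
    (j : Fin p) : Measurable (KLhat P Q S j : ((i : Fin N) → s.PairObs i) → ℝ) :=
  Finset.measurable_sum _ fun i _ => (measurable_klTerm hP hQ hS j).comp (measurable_pi_apply i)

/-- In the ratio of conditional densities the common denominator, the density without predictor $j$,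
cancels. What is left in the divergence term is the ratio of joint densities before and after the
exchange, apart from the missingness factor. -/
theorem pairDensity_eq_exp_klTerm_mul (hP : P.Valid) (hQ : Q.Valid)
    (hS : (Q.cop.knockoffCov S).PosDef) {T : Finset (Fin p)} (hT : SMAR q T) {j : Fin p}
    (hj : j ∉ T) {A : Finset (Fin p)} (y : s.Resp i) {u : (Fin p → ℝ) × (Fin p → ℝ)}
    (h1 : u.1 ∈ s.support A) (h2 : u.2 ∈ s.support A) :
    pairDensity P Q S q A y u = Real.exp (klTerm P Q S j (((A, u.1, y), u.2) : s.PairObs i)) *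
      pairDensity P Q S q A y (swapCoord ({j} ∩ A) u) := by
  obtain ⟨z, z'⟩ := u
  by_cases hjA : j ∈ A
  · have hsupp := Study.swapCoord_mem_support h1 h2 {j}
    rw [Finset.singleton_inter_of_mem hjA]
    rw [swapCoord_singleton] at hsupp ⊢
    simp only at h1 h2 hsupp
    -- The only use of $j\notin T$: the missingness probability does not see predictor $j$.
    have hq : q i A (Function.update z j (z' j)) = q i A z := hT i A _ _ fun k hk => by
      have : k ≠ j := fun h => hj (h ▸ Finset.mem_of_mem_inter_right hk)
      simp [this]
    have e1 := Model.obsDensity_pos hP h1 y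
    have e2 := Model.obsDensity_pos hP (Study.mem_support_erase h1 j) y
    have e3 := Model.obsDensity_pos hP hsupp.1 y
    have e4 := Model.knockoffDensity_pos hQ hS h1 h2 y
    have e5 := Model.knockoffDensity_pos hQ hS hsupp.1 hsupp.2 y
    simp only [klTerm, hjA, if_true, Model.condDensity, Function.update_eq_self, pairDensity, hq]
    rw [Real.exp_log (by positivity)]
    field_simp
  · rw [Finset.singleton_inter_of_notMem hjA]
    simp [klTerm, hjA, swapCoord]

/-- The exchange is an involution preserving the reference measure, so the density of the image law
is the exchanged density, and the ratio identity applies almost everywhere. -/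
theorem pairLaw_eq_withDensity (hP : P.Valid) (hQ : Q.Valid) (hS : (Q.cop.knockoffCov S).PosDef)
    (hq : IsMissingness q) {T : Finset (Fin p)} (hT : SMAR q T) {j : Fin p} (hj : j ∉ T) :
    pairLaw P Q S q i = ((pairLaw P Q S q i).map (swapObs {j})).withDensity
      fun d => ENNReal.ofReal (Real.exp (klTerm P Q S j d)) := by
  have hs := measurable_swapObs (s := s) (i := i) {j}
  have hr : Measurable fun d : s.PairObs i => ENNReal.ofReal (Real.exp (klTerm P Q S j d)) :=
    (measurable_klTerm hP hQ hS j).exp.ennreal_ofReal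
  refine Measure.ext_of_lintegral _ fun φ hφ => ?_
  rw [lintegral_withDensity_eq_lintegral_mul _ hr hφ, lintegral_map (hr.mul hφ) hs,
    lintegral_pairLaw hP hQ hS hq hT hφ]
  refine Eq.trans ?_ (lintegral_pairLaw hP hQ hS hq hT ((hr.mul hφ).comp hs)).symm
  refine Finset.sum_congr rfl fun A _ => Finset.sum_congr rfl fun y _ => ?_
  have hmp : MeasurePreserving (swapCoord ({j} ∩ A)) ((s.obsBase A).prod (s.obsBase A))
      ((s.obsBase A).prod (s.obsBase A)) := by
    have := measurePreserving_swapCoord ({j} ∩ A) (s.baseAt A) (s.baseAt A)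
    simp only [ite_self] at this
    exact this
  have hA : Measurable fun u : (Fin p → ℝ) × (Fin p → ℝ) =>
      (((A, u.1, y), u.2) : s.PairObs i) := by fun_prop
  have hG : Measurable fun u : (Fin p → ℝ) × (Fin p → ℝ) =>
      ENNReal.ofReal (pairDensity P Q S q A y (swapCoord ({j} ∩ A) u)) *
        (ENNReal.ofReal (Real.exp (klTerm P Q S j (((A, u.1, y), u.2) : s.PairObs i))) *
          φ ((A, u.1, y), u.2)) :=
    ((measurable_pairDensity hP hQ hS hq A y).comp (measurable_swapCoord _)).ennreal_ofReal.mul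
      ((hr.comp hA).mul (hφ.comp hA))
  have h := hmp.lintegral_comp hG
  simp only [swapCoord_swapCoord] at h
  simp only [Function.comp_apply, swapObs_mk, Pi.mul_apply]
  rw [h]
  refine lintegral_congr_ae ?_
  filter_upwards [Measure.quasiMeasurePreserving_fst.ae (s.ae_mem_support A),
    Measure.quasiMeasurePreserving_snd.ae (s.ae_mem_support A)] with u h1 h2
  rw [pairDensity_eq_exp_klTerm_mul hP hQ hS hT hj y h1 h2,
    ENNReal.ofReal_mul (Real.exp_pos _).le]
  ring

theorem pi_pairLaw_eq_withDensity (hP : P.Valid) (hQ : Q.Valid)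
    (hS : (Q.cop.knockoffCov S).PosDef) (hq : IsMissingness q) {T : Finset (Fin p)}
    (hT : SMAR q T) {j : Fin p} (hj : j ∉ T) :
    Measure.pi (fun i => pairLaw P Q S q i) =
      ((Measure.pi fun i => pairLaw P Q S q i).map (swapPair {j})).withDensity
        fun d => ENNReal.ofReal (Real.exp (KLhat P Q S j d)) := by
  have := fun i => isFiniteMeasure_pairLaw (i := i) hP hQ hS hq
  have h := fun i => pairLaw_eq_withDensity (i := i) hP hQ hS hq hT hj
  have hfin : ∀ i, SigmaFinite (((pairLaw P Q S q i).map (swapObs {j})).withDensity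
      fun d => ENNReal.ofReal (Real.exp (klTerm P Q S j d))) := fun i => by
    rw [← h i]; infer_instance
  conv_lhs => rw [funext h]
  rw [pi_withDensity fun i => (measurable_klTerm hP hQ hS j).exp.ennreal_ofReal,
    ← Measure.pi_map_pi fun i => (measurable_swapObs {j}).aemeasurable]
  congr 1
  ext d
  rw [KLhat_eq_sum, Real.exp_sum, ENNReal.ofReal_prod_of_nonneg fun _ _ => (Real.exp_pos _).le]

theorem measurable_swapPair (T : Finset (Fin p)) :
    Measurable (swapPair T : ((i : Fin N) → s.PairObs i) → _) :=
  measurable_pi_lambda _ fun i => (measurable_swapObs T).comp (measurable_pi_apply i)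

/-- On the event in question the density with respect to the exchanged law is at most $e^\epsilon$.
-/
theorem pi_pairLaw_inter_le (hP : P.Valid) (hQ : Q.Valid)
    (hS : (Q.cop.knockoffCov S).PosDef) (hq : IsMissingness q) {T : Finset (Fin p)}
    (hT : SMAR q T) {j : Fin p} (hj : j ∉ T) (ε : ℝ) {B : Set ((i : Fin N) → s.PairObs i)}
    (hB : MeasurableSet B) :
    Measure.pi (fun i => pairLaw P Q S q i) (B ∩ {d | KLhat P Q S j d ≤ ε}) ≤
      ENNReal.ofReal (Real.exp ε) * Measure.pi (fun i => pairLaw P Q S q i) (swapPair {j} ⁻¹' B) := by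
  have hm : MeasurableSet (B ∩ {d | KLhat P Q S j d ≤ ε}) :=
    hB.inter (measurable_KLhat hP hQ hS j measurableSet_Iic)
  conv_lhs => rw [pi_pairLaw_eq_withDensity hP hQ hS hq hT hj]
  rw [withDensity_apply _ hm, ← Measure.map_apply (measurable_swapPair _) hB]
  calc _ ≤ ∫⁻ _ in B ∩ {d | KLhat P Q S j d ≤ ε}, ENNReal.ofReal (Real.exp ε)
        ∂((Measure.pi fun i => pairLaw P Q S q i).map (swapPair {j})) :=
        setLIntegral_mono measurable_const fun d hd =>
          ENNReal.ofReal_le_ofReal (Real.exp_le_exp.2 hd.2)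
    _ ≤ _ := by
        rw [setLIntegral_const]
        gcongr
        exact Set.inter_subset_left

end Tilt

/-! ### The likelihood-based statistics have the flip-sign property -/

section LikelihoodStatistics

variable {N p J : ℕ} {s : Study N p J}

/-- Exchange the slopes of the predictors in `T` with those of their knockoffs. -/
def ExtParam.swap (T : Finset (Fin p)) (θ : ExtParam s) : ExtParam s where
  intercept := θ.intercept
  β := fun j => if j ∈ T then θ.γ j else θ.β j
  γ := fun j => if j ∈ T then θ.β j else θ.γ j
  resVar := θ.resVar

@[simp]
theorem ExtParam.swap_swap (T : Finset (Fin p)) (θ : ExtParam s) : (θ.swap T).swap T = θ := by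
  obtain ⟨a, β, γ, v⟩ := θ
  simp only [ExtParam.swap, ExtParam.mk.injEq, true_and, and_true]
  constructor <;> funext j <;> split_ifs <;> rfl

/-- Exchange the copies of the indices in `T`. -/
def swapIndex (T : Finset (Fin p)) : Fin p ⊕ Fin p → Fin p ⊕ Fin p :=
  Sum.elim (fun j => if j ∈ T then .inr j else .inl j) (fun j => if j ∈ T then .inl j else .inr j)

theorem involutive_swapIndex (T : Finset (Fin p)) : Function.Involutive (swapIndex T) := by
  rintro (j | j) <;> by_cases hj : j ∈ T <;> simp [swapIndex, hj]

/-- Exchanging the copies of the indices in $T$ leaves $G$ unchanged: off the diagonal all four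
blocks agree, and on it each index has a symmetric two-by-two block. -/
theorem gaussDensity_knockoffCov_swapCoord (c : Copula p) (S : Fin p → ℝ) (T : Finset (Fin p))
    (u : (Fin p → ℝ) × (Fin p → ℝ)) :
    gaussDensity (c.knockoffCov S) (Sum.elim (swapCoord T u).1 (swapCoord T u).2) =
      gaussDensity (c.knockoffCov S) (Sum.elim u.1 u.2) := by
  have he : (c.knockoffCov S).submatrix ((involutive_swapIndex T).toPerm _)
      ((involutive_swapIndex T).toPerm _) = c.knockoffCov S := by
    ext (j | j) (k | k) <;> by_cases hj : j ∈ T <;> by_cases hk : k ∈ T <;>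
      simp only [Matrix.submatrix_apply, Function.Involutive.coe_toPerm, swapIndex, Sum.elim_inl,
        Sum.elim_inr, hj, hk, if_true, if_false, Copula.knockoffCov, Matrix.fromBlocks_apply₁₁,
        Matrix.fromBlocks_apply₁₂, Matrix.fromBlocks_apply₂₁, Matrix.fromBlocks_apply₂₂,
        Matrix.sub_apply] <;>
      -- Exactly one of the indices lies in $T$, so they differ and the diagonal matrix contributes
      -- nothing.
      · have hjk : j ≠ k := by
          rintro rfl
          contradiction
        simp [hjk]
  rw [← gaussDensity_comp_equiv _ he]
  congr 1
  ext (j | j) <;> by_cases hj : j ∈ T <;> simp [swapCoord, swapIndex, hj]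

theorem linPred_swap (T : Finset (Fin p)) (θ : ExtParam s) (c : Copula p)
    (u : (Fin p → ℝ) × (Fin p → ℝ)) :
    s.linPred (θ.swap T).β (c.transVec s (swapCoord T u).1) +
        s.linPred (θ.swap T).γ (c.transVec s (swapCoord T u).2) =
      s.linPred θ.β (c.transVec s u.1) + s.linPred θ.γ (c.transVec s u.2) := by
  simp only [Study.linPred, ← Finset.sum_add_distrib]
  refine Finset.sum_congr rfl fun j _ => ?_
  by_cases hj : j ∈ T <;> simp only [ExtParam.swap, swapCoord, Copula.transVec, hj, if_true,
    if_false]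
  exact Finset.sum_congr rfl fun k _ => add_comm _ _

/-- Outside $A$ both copies carry Lebesgue measure on their fibres. Exchanging all of $T$ among the
underlying variables thus corresponds to exchanging $T\cap A$ among the observed ones. -/
theorem extDensity_swap (c : Copula p) (S : Fin p → ℝ) (θ : ExtParam s) {i : Fin N}
    (T A : Finset (Fin p)) (u : (Fin p → ℝ) × (Fin p → ℝ)) (y : s.Resp i) :
    c.extDensity s S (θ.swap T) A (swapCoord (T ∩ A) u).1 (swapCoord (T ∩ A) u).2 y =
      c.extDensity s S θ A u.1 u.2 y := by
  have h := measurePreserving_swapCoord T (fun j => c.fibreAt s A j (u.1 j))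
    (fun j => c.fibreAt s A j (u.2 j))
  have h1 : (fun j => if j ∈ T then c.fibreAt s A j (u.2 j) else c.fibreAt s A j (u.1 j)) =
      fun j => c.fibreAt s A j ((swapCoord (T ∩ A) u).1 j) := by
    funext j
    by_cases hT : j ∈ T <;> by_cases hA : j ∈ A <;> simp [swapCoord, Copula.fibreAt, hT, hA]
  have h2 : (fun j => if j ∈ T then c.fibreAt s A j (u.1 j) else c.fibreAt s A j (u.2 j)) =
      fun j => c.fibreAt s A j ((swapCoord (T ∩ A) u).2 j) := by
    funext j
    by_cases hT : j ∈ T <;> by_cases hA : j ∈ A <;> simp [swapCoord, Copula.fibreAt, hT, hA]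
  rw [h1, h2] at h
  let e := MeasurableEquiv.ofInvolutive (swapCoord T : (Fin p → ℝ) × (Fin p → ℝ) → _)
    (swapCoord_swapCoord T) (measurable_swapCoord T)
  have h3 : MeasurePreserving e _ _ := h
  unfold Copula.extDensity
  simp only [Copula.fibreVec_eq]
  rw [← h3.integral_comp']
  refine integral_congr_ae (ae_of_all _ fun v => ?_)
  have he : e v = swapCoord T v := rfl
  dsimp only
  rw [he, gaussDensity_knockoffCov_swapCoord, add_assoc, linPred_swap, ← add_assoc]
  rfl

variable (c : Copula p) (S : Fin p → ℝ) (d : (i : Fin N) → s.PairObs i)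

theorem extLogLik_swap (T : Finset (Fin p)) (θ : ExtParam s) :
    c.extLogLik s S (swapPair T d) (θ.swap T) = c.extLogLik s S d θ := by
  refine Finset.sum_congr rfl fun i _ => ?_
  rw [← extDensity_swap c S θ T (d i).1.1 ((d i).1.2.1, (d i).2) (d i).1.2.2]
  simp [swapPair, swapCoord]

theorem IsMLE_swap (T : Finset (Fin p)) (θ : ExtParam s) :
    c.IsMLE s S (swapPair T d) (θ.swap T) ↔ c.IsMLE s S d θ := by
  refine and_congr Iff.rfl ⟨fun h θ' h' => ?_, fun h θ' h' => ?_⟩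
  · have := h (θ'.swap T) h'
    rwa [extLogLik_swap, extLogLik_swap] at this
  · have := h (θ'.swap T) h'
    rwa [← extLogLik_swap c S d T (θ'.swap T), ExtParam.swap_swap, ← extLogLik_swap c S d T θ]
      at this

theorem likStat_of_unique {θ : ExtParam s} (h : c.IsMLE s S d θ)
    (hu : ∀ θ', c.IsMLE s S d θ' → θ' = θ) (j : Fin p) :
    c.likStat s S d j = Real.sign (c.stdNorm s j (θ.β j) - c.stdNorm s j (θ.γ j)) *
      max (c.stdNorm s j (θ.β j) / Real.sqrt (s.kind j).dim)
        (c.stdNorm s j (θ.γ j) / Real.sqrt (s.kind j).dim) := by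
  have hex : ∃! θ, c.IsMLE s S d θ := ⟨θ, h, hu⟩
  rw [Copula.likStat, dif_pos hex, hu _ hex.choose_spec.1]

theorem likStat_of_not_unique (h : ¬ ∃! θ, c.IsMLE s S d θ) (j : Fin p) :
    c.likStat s S d j = 0 := by
  rw [Copula.likStat, dif_neg h]

/-- Exchanging the data carries the unique maximiser to the one with exchanged slopes, and
uniqueness fails for both data sets or neither. Predictor and knockoff are standardised by the same
covariance, so the two norms trade places; the sign is odd and the maximum symmetric in them. -/
theorem flipSign_likStat : FlipSign (c.likStat s S : ((i : Fin N) → s.PairObs i) → Fin p → ℝ) := by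
  intro T d j
  by_cases h : ∃! θ, c.IsMLE s S d θ
  · obtain ⟨θ, hθ, hu⟩ := h
    have hu' : ∀ θ', c.IsMLE s S (swapPair T d) θ' → θ' = θ.swap T := fun θ' h' => by
      rw [← ExtParam.swap_swap T θ', IsMLE_swap] at h'
      rw [← hu _ h', ExtParam.swap_swap]
    rw [likStat_of_unique c S _ ((IsMLE_swap c S d T θ).2 hθ) hu', likStat_of_unique c S d hθ hu]
    by_cases hj : j ∈ T
    · simp only [ExtParam.swap, hj, if_true]
      rw [← neg_sub, Real.sign_neg, max_comm, neg_mul]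
    · simp only [ExtParam.swap, hj, if_false]
  · have h' : ¬ ∃! θ, c.IsMLE s S (swapPair T d) θ := by
      rintro ⟨θ, hθ, hu⟩
      refine h ⟨θ.swap T, ?_, fun θ' h' => ?_⟩
      · rwa [← ExtParam.swap_swap T θ, IsMLE_swap] at hθ
      · rw [← hu _ ((IsMLE_swap c S d T θ').2 h'), ExtParam.swap_swap]
    rw [likStat_of_not_unique c S d h, likStat_of_not_unique c S _ h']
    simp

end LikelihoodStatistics

/-! ### The baseline selection -/

section Baseline

variable {N p J : ℕ} {s : Study N p J} {W : Fin p → ℝ} {ν : ℕ}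

theorem negCount_anti (W : Fin p → ℝ) : Antitone (negCount W) := by
  classical
  intro t t' h
  unfold negCount
  gcongr

theorem negCount_eq_sum (W : Fin p → ℝ) (t : ℝ) :
    negCount W t = 1 + ∑ j, open Classical in if W j < -t then 1 else 0 := by
  rw [negCount, Finset.card_filter]

theorem exists_negCount_le (hν : 1 ≤ ν) (W : Fin p → ℝ) :
    {t : ℝ | 0 < t ∧ negCount W t ≤ ν}.Nonempty := by
  refine ⟨1 + ∑ j, |W j|, add_pos_of_pos_of_nonneg one_pos
    (Finset.sum_nonneg fun _ _ => abs_nonneg _), ?_⟩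
  rw [negCount, Finset.filter_eq_empty_iff.2, Finset.card_empty]
  · exact hν
  · intro j _
    have := Finset.single_le_sum (f := fun j => |W j|) (fun _ _ => abs_nonneg _) (Finset.mem_univ j)
    have := neg_abs_le (W j)
    linarith

/-- The strict inequality makes the count right-continuous: among the finitely many indices counted
at the infimum, the largest $W_j$ leaves room for some $t\in A$ at which all of them are still
counted. -/
theorem negCount_sInf_le (hν : 1 ≤ ν) {A : Set ℝ} (hA : A.Nonempty)
    (h : ∀ t ∈ A, negCount W t ≤ ν) : negCount W (sInf A) ≤ ν := by
  classical
  by_cases hne : (Finset.univ.filter fun j => W j < -sInf A).Nonempty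
  · obtain ⟨j, hj, hmax⟩ := Finset.exists_max_image _ W hne
    obtain ⟨t, ht, htj⟩ := exists_lt_of_csInf_lt hA
      (show sInf A < -W j by linarith [(Finset.mem_filter.1 hj).2])
    refine le_trans ?_ (h t ht)
    unfold negCount
    gcongr 1 + ?_
    refine Finset.card_le_card fun k hk => ?_
    have hk' := hmax k (by simpa using hk)
    simp only [Finset.mem_filter, Finset.mem_univ, true_and]
    linarith
  · rw [Finset.not_nonempty_iff_eq_empty, Finset.filter_eq_empty_iff] at hne
    rw [negCount, Finset.filter_eq_empty_iff.2, Finset.card_empty]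
    exacts [hν, hne]

theorem negCount_threshold_le (hν : 1 ≤ ν) (W : Fin p → ℝ) :
    negCount W (threshold ν W) ≤ ν := by
  unfold threshold
  split_ifs with h
  · exact negCount_sInf_le hν h fun t ht => ht.2.le
  · exact negCount_sInf_le hν (exists_negCount_le hν W) fun t ht => ht.2

theorem threshold_nonneg (ν : ℕ) (W : Fin p → ℝ) : 0 ≤ threshold ν W := by
  unfold threshold
  split_ifs <;> exact Real.sInf_nonneg fun t ht => ht.1.le

/-- Reconciles the two cases in the definition of the threshold: as the count is antitone, any $t$
with count below $\nu$ lies to the right of any $t_0$ with count equal to $\nu$. -/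
theorem threshold_le {t : ℝ} (ht : 0 < t) (h : negCount W t ≤ ν) : threshold ν W ≤ t := by
  have hb : ∀ P : ℝ → Prop, BddBelow {t : ℝ | 0 < t ∧ P t} := fun P => ⟨0, fun t ht => ht.1.le⟩
  unfold threshold
  split_ifs with hne
  · rcases h.eq_or_lt with h | h
    · exact csInf_le (hb _) ⟨ht, h⟩
    · obtain ⟨t₀, ht₀⟩ := hne
      refine (csInf_le (hb _) ht₀).trans ?_
      by_contra hlt
      have := negCount_anti W (not_le.1 hlt).le
      rw [ht₀.2] at this
      omega
  · exact csInf_le (hb _) ⟨ht, h⟩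

theorem mem_baseline {j : Fin p} : j ∈ baseline ν W ↔ threshold ν W < W j := by
  simp [baseline]

/-- Writes selection as a countable union of events, which gives measurability without treating the
infimum as a random variable. -/
theorem mem_baseline_iff_exists_rat (hν : 1 ≤ ν) {j : Fin p} :
    j ∈ baseline ν W ↔ ∃ r : ℚ, (0 : ℝ) < r ∧ (r : ℝ) < W j ∧ negCount W r ≤ ν := by
  rw [mem_baseline]
  constructor
  · intro h
    obtain ⟨r, h1, h2⟩ := exists_rat_btwn h
    exact ⟨r, (threshold_nonneg ν W).trans_lt h1, h2,
      (negCount_anti W h1.le).trans (negCount_threshold_le hν W)⟩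
  · rintro ⟨r, h0, h1, h2⟩
    exact (threshold_le h0 h2).trans_lt h1

theorem measurableSet_mem_baseline (hν : 1 ≤ ν) (j : Fin p) :
    MeasurableSet {W : Fin p → ℝ | j ∈ baseline ν W} := by
  simp_rw [mem_baseline_iff_exists_rat hν]
  rw [show {W : Fin p → ℝ | ∃ r : ℚ, (0 : ℝ) < r ∧ (r : ℝ) < W j ∧ negCount W r ≤ ν} =
    ⋃ r : ℚ, {W | (0 : ℝ) < r ∧ (r : ℝ) < W j ∧ negCount W r ≤ ν} by ext; simp]
  refine MeasurableSet.iUnion fun r => ?_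
  have h1 : Measurable fun W : Fin p → ℝ => negCount W r := by
    simp_rw [negCount_eq_sum]
    refine measurable_const.add (Finset.measurable_sum _ fun k _ => ?_)
    exact Measurable.ite (measurable_pi_apply k measurableSet_Iio) measurable_const measurable_const
  exact (MeasurableSet.const _).inter ((measurable_pi_apply j measurableSet_Ioi).inter
    (h1 measurableSet_Iic))

/-- Let $\tau_j$ be the threshold after reversing $W_j$. A counted $j$ has $W_j<-\tau_j$. For the
counted $j$ with smallest $\tau_j$, every other counted $k$ satisfies $W_k<-\tau_k\le-\tau_j$ and so
is among the negative statistics that $\tau_j$ limits. -/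
theorem card_mem_baseline_neg_le (hν : 1 ≤ ν) (W : Fin p → ℝ) :
    (open Classical in Finset.univ.filter fun j =>
      j ∈ baseline ν (Function.update W j (-W j))).card ≤ ν := by
  classical
  set F := Finset.univ.filter fun j => j ∈ baseline ν (Function.update W j (-W j)) with hF
  let τ : Fin p → ℝ := fun j => threshold ν (Function.update W j (-W j))
  have hmem : ∀ j ∈ F, W j < -τ j := fun j hj => by
    have := mem_baseline.1 (Finset.mem_filter.1 hj).2
    rw [Function.update_self] at this
    linarith
  rcases F.eq_empty_or_nonempty with h | h
  · simp [h]
  · obtain ⟨j, hj, hmin⟩ := Finset.exists_min_image F τ h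
    have hle := negCount_threshold_le hν (Function.update W j (-W j))
    refine le_trans ?_ hle
    -- The leading $1$ in the count pays for $j$ itself, whose reversed statistic is positive.
    rw [negCount, add_comm]
    refine le_trans (Finset.card_le_card (t := insert j (Finset.univ.filter fun k =>
      Function.update W j (-W j) k < -τ j)) fun k hk => ?_) (Finset.card_insert_le _ _)
    by_cases hkj : k = j
    · exact Finset.mem_insert.2 (Or.inl hkj)
    · refine Finset.mem_insert_of_mem (Finset.mem_filter.2 ⟨Finset.mem_univ _, ?_⟩)
      rw [Function.update_of_ne hkj]
      linarith [hmem k hk, hmin k hk]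

theorem FlipSign.swapPair_singleton {w : ((i : Fin N) → s.PairObs i) → Fin p → ℝ}
    (hw : FlipSign w) (d : (i : Fin N) → s.PairObs i) (j : Fin p) :
    w (swapPair {j} d) = Function.update (w d) j (-w d j) := by
  funext k
  rw [hw {j} d k]
  by_cases h : k = j
  · subst h; simp
  · simp [h]

end Baseline

/-! ### Control of the expected number of false selections -/

section Control

variable {N p J M : ℕ} {s : Study N p J}

variable {P Q : Model s} {S : Fin p → ℝ} {q : Fin N → Finset (Fin p) → (Fin p → ℝ) → ℝ}
  {w : ((i : Fin N) → s.PairObs i) → Fin p → ℝ} {ν : ℕ} {ε : ℝ}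

theorem sum_pi_pairLaw_le (hP : P.Valid) (hQ : Q.Valid) (hS : (Q.cop.knockoffCov S).PosDef)
    (hq : IsMissingness q) (hSMAR : SMAR q P.nonnull) (hwm : Measurable w) (hw : FlipSign w)
    (hν : 1 ≤ ν) [IsProbabilityMeasure (Measure.pi fun i => pairLaw P Q S q i)] :
    ∑ j ∈ P.nonnullᶜ, Measure.pi (fun i => pairLaw P Q S q i)
      {d | j ∈ baseline ν (w d) ∧ KLhat P Q S j d ≤ ε} ≤ ν * ENNReal.ofReal (Real.exp ε) := by
  classical
  set L := Measure.pi fun i => pairLaw P Q S q i with hL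
  have hB : ∀ j, MeasurableSet {d | j ∈ baseline ν (w d)} := fun j =>
    hwm (measurableSet_mem_baseline hν j)
  calc _ ≤ ∑ j ∈ P.nonnullᶜ, ENNReal.ofReal (Real.exp ε) *
        L (swapPair {j} ⁻¹' {d | j ∈ baseline ν (w d)}) :=
        Finset.sum_le_sum fun j hj =>
          pi_pairLaw_inter_le hP hQ hS hq hSMAR (Finset.mem_compl.1 hj) ε (hB j)
    -- Non-null indices may be added now, since the deterministic bound counts all indices.
    _ ≤ ENNReal.ofReal (Real.exp ε) *
        ∑ j, L (swapPair {j} ⁻¹' {d | j ∈ baseline ν (w d)}) := by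
        rw [← Finset.mul_sum]
        gcongr
        exact Finset.subset_univ _
    _ = ENNReal.ofReal (Real.exp ε) *
        ∫⁻ d, ∑ j, (swapPair {j} ⁻¹' {d | j ∈ baseline ν (w d)}).indicator 1 d ∂L := by
        rw [lintegral_finsetSum _ fun j _ =>
          measurable_one.indicator (measurable_swapPair {j} (hB j))]
        simp_rw [lintegral_indicator_one (measurable_swapPair _ (hB _))]
    _ ≤ ENNReal.ofReal (Real.exp ε) * ∫⁻ _, ν ∂L := by
        gcongr with d
        have h := card_mem_baseline_neg_le hν (w d)
        rw [Finset.card_filter] at h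
        refine le_trans (le_of_eq ?_) (Nat.cast_le (α := ℝ≥0∞).2 h)
        push_cast
        refine Finset.sum_congr rfl fun j _ => ?_
        rw [Set.indicator_apply, Set.mem_preimage, Set.mem_ofPred_eq, hw.swapPair_singleton]
        congr!
    _ = ν * ENNReal.ofReal (Real.exp ε) := by
        rw [lintegral_const, measure_univ, mul_one, mul_comm]

/-! ### Derandomisation on the underlying probability space -/

variable {Ω : Type*} {X : (i : Fin N) → Ω → s.Obs i} {Z : Fin M → Fin N → Ω → Fin p → ℝ}

theorem hasLaw_runData [MeasurableSpace Ω] {μ : Measure Ω} (hP : P.Valid)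
    (hQ : Q.Valid) (hS : (Q.cop.knockoffCov S).PosDef) (hq : IsMissingness q)
    (hlaw : HasLaw (fun ω i => (X i ω, fun m => Z m i ω)) (studyLaw P Q S q M) μ) (m : Fin M) :
    HasLaw (runData X Z m) (Measure.pi fun i => pairLaw P Q S q i) μ := by
  have hm : Measurable fun (d : (i : Fin N) → s.Obs i × (Fin M → Fin p → ℝ)) i =>
      (((d i).1, (d i).2 m) : s.PairObs i) := by
    refine measurable_pi_lambda _ fun i => ?_
    have h : Measurable fun x : s.Obs i × (Fin M → Fin p → ℝ) => ((x.1, x.2 m) : s.PairObs i) := by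
      fun_prop
    exact h.comp (measurable_pi_apply i)
  refine ⟨hm.comp_aemeasurable hlaw.aemeasurable, ?_⟩
  rw [← map_studyLaw hP hQ hS hq m, ← hlaw.map_eq,
    AEMeasurable.map_map_of_aemeasurable hm.aemeasurable hlaw.aemeasurable]
  rfl

/-- The event that run `m` selects `j` with observed divergence at most `ε`. -/
def selEvent (P Q : Model s) (S : Fin p → ℝ) (w : ((i : Fin N) → s.PairObs i) → Fin p → ℝ)
    (ν : ℕ) (ε : ℝ) (X : (i : Fin N) → Ω → s.Obs i) (Z : Fin M → Fin N → Ω → Fin p → ℝ)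
    (j : Fin p) (m : Fin M) : Set Ω :=
  {ω | j ∈ runSel w ν X Z ω m ∧ KLhat P Q S j (runData X Z m ω) ≤ ε}

theorem PiDagger_eq (P Q : Model s) (S : Fin p → ℝ)
    (w : ((i : Fin N) → s.PairObs i) → Fin p → ℝ) (ν : ℕ) (ε : ℝ)
    (X : (i : Fin N) → Ω → s.Obs i) (Z : Fin M → Fin N → Ω → Fin p → ℝ) (j : Fin p) (ω : Ω) :
    PiDagger P Q S w ν ε X Z j ω =
      (∑ m, (selEvent P Q S w ν ε X Z j m).indicator (fun _ => (1 : ℝ)) ω) / M := by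
  simp only [PiDagger, selEvent, Set.indicator_apply, Set.mem_ofPred_eq]

theorem exists_PiDagger_eq (P Q : Model s) (S : Fin p → ℝ)
    (w : ((i : Fin N) → s.PairObs i) → Fin p → ℝ) (ν : ℕ) (ε : ℝ)
    (X : (i : Fin N) → Ω → s.Obs i) (Z : Fin M → Fin N → Ω → Fin p → ℝ) (j : Fin p) (ω : Ω) :
    ∃ n : ℕ, n ≤ M ∧ PiDagger P Q S w ν ε X Z j ω = (n : ℝ) / M := by
  classical
  refine ⟨(Finset.univ.filter fun m => ω ∈ selEvent P Q S w ν ε X Z j m).card,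
    (Finset.card_le_univ _).trans (by simp), ?_⟩
  rw [PiDagger_eq, Finset.card_filter]
  push_cast
  simp only [Set.indicator_apply]

/-- With the divergence bounded in every run, the restriction in $\Pi_j^\dagger$ is void and it
equals the selection frequency. -/
theorem mem_selectedNulls_iff {η : ℝ} {ω : Ω} {j : Fin p} :
    j ∈ selectedNulls P Q S w ν η ε X Z ω ↔ j ∉ P.nonnull ∧
      η ≤ PiDagger P Q S w ν ε X Z j ω ∧ ∀ m, KLhat P Q S j (runData X Z m ω) ≤ ε := by
  simp only [selectedNulls, derandomised, Finset.mem_filter, Finset.mem_sdiff, Finset.mem_univ,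
    true_and]
  have h : (∀ m, KLhat P Q S j (runData X Z m ω) ≤ ε) →
      frequency (runSel w ν X Z ω) j = PiDagger P Q S w ν ε X Z j ω := fun h => by
    simp only [frequency, PiDagger, h, and_true]
  constructor
  · rintro ⟨⟨h1, h2⟩, h3⟩
    exact ⟨h2, h h3 ▸ h1, h3⟩
  · rintro ⟨h1, h2, h3⟩
    exact ⟨⟨(h h3).symm ▸ h2, h1⟩, h3⟩

variable [MeasurableSpace Ω] {μ : Measure Ω}

theorem integral_indicator_one_eq {B : Set Ω} (hB : NullMeasurableSet B μ) :
    ∫ ω, B.indicator (fun _ => (1 : ℝ)) ω ∂μ = μ.real B := by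
  rw [integral_indicator₀ hB, setIntegral_const, smul_eq_mul, mul_one]

variable [IsProbabilityMeasure μ]

theorem integrable_indicator_one {B : Set Ω} (hB : NullMeasurableSet B μ) :
    Integrable (B.indicator fun _ => (1 : ℝ)) μ :=
  (integrable_const (1 : ℝ)).indicator₀ hB

theorem aemeasurable_PiDagger (hE : ∀ j m, NullMeasurableSet (selEvent P Q S w ν ε X Z j m) μ)
    (j : Fin p) : AEMeasurable (PiDagger P Q S w ν ε X Z j) μ := by
  rw [show PiDagger P Q S w ν ε X Z j = _ from funext (PiDagger_eq P Q S w ν ε X Z j)]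
  exact (Finset.aemeasurable_fun_sum _ fun m _ =>
    (integrable_indicator_one (hE j m)).aestronglyMeasurable.aemeasurable).div_const _

theorem integral_PiDagger (hE : ∀ j m, NullMeasurableSet (selEvent P Q S w ν ε X Z j m) μ)
    (j : Fin p) : ∫ ω, PiDagger P Q S w ν ε X Z j ω ∂μ =
      (∑ m, μ.real (selEvent P Q S w ν ε X Z j m)) / M := by
  simp_rw [PiDagger_eq]
  rw [integral_div, integral_finsetSum _ fun m _ => integrable_indicator_one (hE j m)]
  simp_rw [integral_indicator_one_eq (hE j _)]

theorem integral_card_selectedNulls_le {η : ℝ}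
    (hE : ∀ j m, NullMeasurableSet (selEvent P Q S w ν ε X Z j m) μ)
    (hKL : ∀ j m, NullMeasurableSet {ω | KLhat P Q S j (runData X Z m ω) ≤ ε} μ)
    (hη : ∀ j, j ∉ P.nonnull →
      μ.real {ω | η ≤ PiDagger P Q S w ν ε X Z j ω} ≤ ∫ ω, PiDagger P Q S w ν ε X Z j ω ∂μ) :
    Integrable (fun ω => ((selectedNulls P Q S w ν η ε X Z ω).card : ℝ)) μ ∧
      ∫ ω, ((selectedNulls P Q S w ν η ε X Z ω).card : ℝ) ∂μ ≤
        (∑ m, ∑ j ∈ P.nonnullᶜ, μ.real (selEvent P Q S w ν ε X Z j m)) / M := by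
  classical
  let C : Fin p → Set Ω := fun j => {ω | j ∈ selectedNulls P Q S w ν η ε X Z ω}
  have hC : ∀ j ∈ P.nonnullᶜ, NullMeasurableSet (C j) μ := fun j hj => by
    have h : C j = {ω | η ≤ PiDagger P Q S w ν ε X Z j ω} ∩
        ⋂ m, {ω | KLhat P Q S j (runData X Z m ω) ≤ ε} := by
      ext ω
      simp [C, mem_selectedNulls_iff, Finset.mem_compl.1 hj]
    rw [h]
    exact (nullMeasurableSet_le aemeasurable_const (aemeasurable_PiDagger hE j)).inter
      (NullMeasurableSet.iInter fun m => hKL j m)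
  have hcard : ∀ ω, ((selectedNulls P Q S w ν η ε X Z ω).card : ℝ) =
      ∑ j ∈ P.nonnullᶜ, (C j).indicator (fun _ => (1 : ℝ)) ω := fun ω => by
    simp only [Set.indicator_apply, C, Set.mem_ofPred_eq]
    rw [Finset.sum_boole]
    congr 2
    ext j
    simp only [Finset.mem_filter, Finset.mem_compl]
    exact ⟨fun h => ⟨(mem_selectedNulls_iff.1 h).1, h⟩, fun h => h.2⟩
  have hint : ∀ j ∈ P.nonnullᶜ, Integrable ((C j).indicator fun _ => (1 : ℝ)) μ := fun j hj =>
    integrable_indicator_one (hC j hj)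
  simp_rw [hcard]
  refine ⟨integrable_finsetSum _ hint, ?_⟩
  rw [integral_finsetSum _ hint, Finset.sum_comm, Finset.sum_div]
  refine Finset.sum_le_sum fun j hj => ?_
  rw [integral_indicator_one_eq (hC j hj), ← integral_PiDagger hE]
  refine le_trans (measureReal_mono fun ω hω => ?_) (hη j (Finset.mem_compl.1 hj))
  exact (mem_selectedNulls_iff.1 hω).2.1

/-- A random variable with values in `{0, 1/31, …, 1}` and non-increasing probability mass
function. -/
theorem measureReal_half_le_integral {Y : Ω → ℝ} (hY : AEMeasurable Y μ)
    (hval : ∀ ω, ∃ n : ℕ, n ≤ 31 ∧ Y ω = n / 31)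
    (hmono : ∀ k l : ℕ, k ≤ l → l ≤ 31 →
      μ.real {ω | Y ω = (l : ℝ) / 31} ≤ μ.real {ω | Y ω = (k : ℝ) / 31}) :
    μ.real {ω | (1 / 2 : ℝ) ≤ Y ω} ≤ ∫ ω, Y ω ∂μ := by
  let B : ℕ → Set Ω := fun k => {ω | Y ω = (k : ℝ) / 31}
  have hB : ∀ k, NullMeasurableSet (B k) μ := fun k =>
    nullMeasurableSet_eq_fun hY aemeasurable_const
  -- Expansion over the atoms; the indicator of $[1/2,\infty)$ gives the tail probability and the
  -- identity gives the mean.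
  have hexp : ∀ (f : ℝ → ℝ) (ω : Ω), f (Y ω) = ∑ k ∈ Finset.range 32,
      f ((k : ℝ) / 31) * (B k).indicator (fun _ => (1 : ℝ)) ω := fun f ω => by
    obtain ⟨n, hn, hω⟩ := hval ω
    rw [Finset.sum_eq_single_of_mem n (Finset.mem_range.2 (by omega))]
    · rw [Set.indicator_of_mem (show ω ∈ B n from hω), hω, mul_one]
    · intro k _ hk
      rw [Set.indicator_of_notMem, mul_zero]
      intro h
      have h' : (n : ℝ) / 31 = (k : ℝ) / 31 := hω.symm.trans h
      have : (n : ℝ) = k := by linarith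
      exact hk (by exact_mod_cast this.symm)
  have hint : ∀ f : ℝ → ℝ, ∫ ω, f (Y ω) ∂μ =
      ∑ k ∈ Finset.range 32, f ((k : ℝ) / 31) * μ.real (B k) := fun f => by
    simp_rw [hexp f]
    rw [integral_finsetSum _ fun k _ => (integrable_indicator_one (hB k)).const_mul _]
    simp_rw [integral_const_mul, integral_indicator_one_eq (hB _)]
  have h1 : μ.real {ω | (1 / 2 : ℝ) ≤ Y ω} =
      ∑ k ∈ Finset.range 32, (Set.Ici (1 / 2 : ℝ)).indicator 1 ((k : ℝ) / 31) * μ.real (B k) := by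
    rw [← hint, ← integral_indicator_one_eq (nullMeasurableSet_le aemeasurable_const hY)]
    rfl
  have h2 := hint id
  simp only [id] at h2
  rw [h1, h2]
  -- Since $k/31\ge1/2$ means $k\ge16$, the claim reads
  -- $\sum_{k\le15}k\,p_k\ge\sum_{k\ge16}(31-k)p_k=\sum_{k\le15}k\,p_{31-k}$, which holds term by
  -- term.
  have hpair : ∀ k ∈ Finset.range 16, (0 : ℝ) ≤ k * (μ.real (B k) - μ.real (B (31 - k))) :=
    fun k hk => mul_nonneg (Nat.cast_nonneg _)
      (sub_nonneg.2 (hmono k (31 - k) (by have := Finset.mem_range.1 hk; omega) (by omega)))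
  have hsum := Finset.sum_nonneg hpair
  simp only [Finset.sum_range_succ, Finset.sum_range_zero, Set.indicator_apply, Set.mem_Ici,
    Pi.one_apply] at hsum ⊢
  norm_num at hsum ⊢
  linarith

end Control

end LatentKnockoff

end

/-! ### The theorem -/

theorem theorem2 {N p J M : ℕ} (s : Study N p J)
    (P Q : Model s) (hP : P.Valid) (hQ : Q.Valid)
    (S : Fin p → ℝ) (hS : (Q.cop.knockoffCov S).PosDef)
    (q : Fin N → Finset (Fin p) → (Fin p → ℝ) → ℝ) (hq : IsMissingness q)
    (hSMAR : SMAR q P.nonnull)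
    (w : ((i : Fin N) → s.PairObs i) → Fin p → ℝ) (hwm : Measurable w)
    (hw : w = Q.cop.likStat s S ∨ FlipSign w)
    {Ω : Type*} [MeasurableSpace Ω] (μ : Measure Ω) [IsProbabilityMeasure μ]
    (X : (i : Fin N) → Ω → s.Obs i) (Z : Fin M → Fin N → Ω → Fin p → ℝ)
    (hlaw : HasLaw (fun ω i => (X i ω, fun m => Z m i ω)) (studyLaw P Q S q M) μ)
    (ν : ℕ) (hν : 1 ≤ ν) (ε : ℝ) (hε : 0 ≤ ε) :
    (∀ η : ℝ,
      (∀ j, j ∉ P.nonnull →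
        μ.real {ω | η ≤ PiDagger P Q S w ν ε X Z j ω} ≤ ∫ ω, PiDagger P Q S w ν ε X Z j ω ∂μ) →
      Integrable (fun ω => ((selectedNulls P Q S w ν η ε X Z ω).card : ℝ)) μ ∧
        ∫ ω, ((selectedNulls P Q S w ν η ε X Z ω).card : ℝ) ∂μ ≤ ν * Real.exp ε) ∧
    (M = 31 → ∀ j, j ∉ P.nonnull →
      (∀ k l : ℕ, k ≤ l → l ≤ M →
        μ.real {ω | PiDagger P Q S w ν ε X Z j ω = (l : ℝ) / M} ≤
          μ.real {ω | PiDagger P Q S w ν ε X Z j ω = (k : ℝ) / M}) →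
      μ.real {ω | (1 / 2 : ℝ) ≤ PiDagger P Q S w ν ε X Z j ω} ≤
        ∫ ω, PiDagger P Q S w ν ε X Z j ω ∂μ) := by
  classical
  have hflip : FlipSign w := by
    rcases hw with rfl | h
    exacts [flipSign_likStat Q.cop S, h]
  have hrun := hasLaw_runData hP hQ hS hq hlaw
  have hKLm : ∀ j, MeasurableSet {d : (i : Fin N) → s.PairObs i | KLhat P Q S j d ≤ ε} :=
    fun j => measurable_KLhat hP hQ hS j measurableSet_Iic
  have hEm : ∀ j, MeasurableSet {d : (i : Fin N) → s.PairObs i |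
      j ∈ baseline ν (w d) ∧ KLhat P Q S j d ≤ ε} := fun j =>
    (hwm (measurableSet_mem_baseline hν j)).inter (hKLm j)
  have hE : ∀ j m, NullMeasurableSet (selEvent P Q S w ν ε X Z j m) μ := fun j m =>
    (hrun m).aemeasurable.nullMeasurable (hEm j)
  have hKL : ∀ j m, NullMeasurableSet {ω | KLhat P Q S j (runData X Z m ω) ≤ ε} μ := fun j m =>
    (hrun m).aemeasurable.nullMeasurable (hKLm j)
  refine ⟨fun η hη => ?_, ?_⟩
  · obtain ⟨h1, h2⟩ := integral_card_selectedNulls_le hE hKL hη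
    refine ⟨h1, h2.trans ?_⟩
    have hb : 0 ≤ (ν : ℝ) * Real.exp ε := mul_nonneg (Nat.cast_nonneg _) (Real.exp_pos _).le
    have hm : ∀ m, ∑ j ∈ P.nonnullᶜ, μ.real (selEvent P Q S w ν ε X Z j m) ≤
        ν * Real.exp ε := fun m => by
      -- The law of one run is the image of a probability measure, so its total mass need not be
      -- computed.
      have hL : IsProbabilityMeasure (Measure.pi fun i => pairLaw P Q S q i) := by
        rw [← (hrun m).map_eq]
        exact Measure.isProbabilityMeasure_map (hrun m).aemeasurable
      have h := sum_pi_pairLaw_le (ε := ε) hP hQ hS hq hSMAR hwm hflip hν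
      simp_rw [← (hrun m).measure_eq (hEm _)] at h
      have h' := ENNReal.toReal_mono (by finiteness) h
      rw [ENNReal.toReal_sum fun j _ => measure_ne_top _ _, ENNReal.toReal_mul,
        ENNReal.toReal_natCast, ENNReal.toReal_ofReal (Real.exp_pos _).le] at h'
      exact h'
    -- This form of the bound also covers $M=0$, where the quotient is $0$.
    refine div_le_of_le_mul₀ (Nat.cast_nonneg _) hb ?_
    refine (Finset.sum_le_sum fun m _ => hm m).trans ?_
    rw [Finset.sum_const, Finset.card_univ, Fintype.card_fin, nsmul_eq_mul, mul_comm]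
  · rintro rfl j - hmono
    exact measureReal_half_le_integral (aemeasurable_PiDagger hE j)
      (fun ω => by simpa using exists_PiDagger_eq P Q S w ν ε X Z j ω)
      (fun k l hkl hl => by simpa using hmono k l hkl hl)
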